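/- For a finite simple undirected graph $G$ with $n$ vertices, $m$ edges and degree sequence $d_1\le d_2\le\dots\le d_n$, let $\alpha(G)$ be the independence number of $G$, that is, the largest number of pairwise non-adjacent vertices, and let $$a(G)=\max\{a\in\{1,\dots,n\} : d_1+\dots+d_a\le m\}$$ be the annihilation number of $G$ (with $a(G)=0$ if $n=0$). **Theorem.** It can be decided in polynomial time whether $\alpha(G)=a(G)$ for a given graph $G$. That is, there are a program for a random access machine (with addition, truncated subtraction, indirect addressing and tests for zero, each of unit cost) and a polynomial $p$ such that the program, given the order $n$ and the adjacency matrix of any finite graph $G$, halts after at most $p(n)$ steps and outputs $1$ if $\alpha(G)=a(G)$ and $0$ otherwise. -/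

import Mathlib

/-! ## The annihilation number -/

namespace SimpleGraph

open Classical in
/-- The degree sequence `d₁ ≤ ⋯ ≤ dₙ` of a finite graph, as a non-decreasing list. -/
noncomputable def degreeSequence {V : Type*} [Fintype V] (G : SimpleGraph V) : List ℕ :=
  ((Finset.univ : Finset V).val.map fun v => G.degree v).sort (· ≤ ·)

open Classical in
/-- The annihilation number `max {a ∈ {1, …, n} : d₁ + ⋯ + d_a ≤ m}` of a graph with `n` vertices,
`m` edges and degree sequence `d₁ ≤ ⋯ ≤ dₙ`. For `n ≥ 1` the set contains `a = 1`, so that this is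
a genuine maximum; the graph without vertices gets the value `0`. -/
noncomputable def annihilationNumber {V : Type*} [Fintype V] (G : SimpleGraph V) : ℕ :=
  ((Finset.Icc 1 (Fintype.card V)).filter fun a =>
    (G.degreeSequence.take a).sum ≤ G.edgeFinset.card).sup id

end SimpleGraph

/-! ## Random access machines and polynomial time

Registers `R₀, R₁, …` and memory cells `M[0], M[1], …` hold natural numbers. Registers are addressed
by fixed numbers in the program, memory cells only indirectly, through the content of a register.
The arithmetic is addition and truncated subtraction (no multiplication), and every elementary
instruction and every test takes one unit of time: in `t` steps the numbers grow by at most `t` bits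
(beyond those of the input and of the constants in the program), so that polynomial time on this
machine is the same as polynomial time on a Turing machine. -/

namespace RAM

/-- The programs of the machine; a program is a finite object that does not depend on the input. -/
inductive Program : Type where
  /-- do nothing -/
  | skip : Program
  /-- `Rᵢ := c` -/
  | const (i c : ℕ) : Program
  /-- `Rᵢ := Rⱼ` -/
  | copy (i j : ℕ) : Program
  /-- `Rᵢ := Rⱼ + Rₖ` -/
  | add (i j k : ℕ) : Program
  /-- `Rᵢ := max (Rⱼ - Rₖ) 0` -/
  | sub (i j k : ℕ) : Program
  /-- `Rᵢ := M[Rⱼ]` -/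
  | load (i j : ℕ) : Program
  /-- `M[Rᵢ] := Rⱼ` -/
  | store (i j : ℕ) : Program
  /-- first `p`, then `q` -/
  | seq (p q : Program) : Program
  /-- if `Rᵢ ≠ 0` then `p` else `q` -/
  | cond (i : ℕ) (p q : Program) : Program
  /-- while `Rᵢ ≠ 0` do `p` -/
  | loop (i : ℕ) (p : Program) : Program

/-- The contents of all registers and of all memory cells. -/
@[ext]
structure State : Type where
  /-- the registers -/
  reg : ℕ → ℕ
  /-- the memory cells -/
  mem : ℕ → ℕ

/-- Write the number `x` to the register `Rᵢ`. -/
def State.setReg (s : State) (i x : ℕ) : State :=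
  { s with reg := Function.update s.reg i x }

/-- Write the number `x` to the memory cell `M[a]`. -/
def State.setMem (s : State) (a x : ℕ) : State :=
  { s with mem := Function.update s.mem a x }

/-- `Runs p s t s'`: started in the state `s`, the program `p` halts, in the state `s'`, after
exactly `t` units of time. -/
inductive Runs : Program → State → ℕ → State → Prop where
  | skip (s : State) : Runs .skip s 1 s
  | const (s : State) (i c : ℕ) : Runs (.const i c) s 1 (s.setReg i c)
  | copy (s : State) (i j : ℕ) : Runs (.copy i j) s 1 (s.setReg i (s.reg j))
  | add (s : State) (i j k : ℕ) : Runs (.add i j k) s 1 (s.setReg i (s.reg j + s.reg k))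
  | sub (s : State) (i j k : ℕ) : Runs (.sub i j k) s 1 (s.setReg i (s.reg j - s.reg k))
  | load (s : State) (i j : ℕ) : Runs (.load i j) s 1 (s.setReg i (s.mem (s.reg j)))
  | store (s : State) (i j : ℕ) : Runs (.store i j) s 1 (s.setMem (s.reg i) (s.reg j))
  | seq {p q : Program} {s s₁ s₂ : State} {t₁ t₂ : ℕ}
      (hp : Runs p s t₁ s₁) (hq : Runs q s₁ t₂ s₂) : Runs (.seq p q) s (t₁ + t₂) s₂
  | cond_true {i : ℕ} {p q : Program} {s s₁ : State} {t : ℕ}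
      (hi : s.reg i ≠ 0) (hp : Runs p s t s₁) : Runs (.cond i p q) s (1 + t) s₁
  | cond_false {i : ℕ} {p q : Program} {s s₁ : State} {t : ℕ}
      (hi : s.reg i = 0) (hq : Runs q s t s₁) : Runs (.cond i p q) s (1 + t) s₁
  | loop_true {i : ℕ} {p : Program} {s s₁ s₂ : State} {t₁ t₂ : ℕ}
      (hi : s.reg i ≠ 0) (hp : Runs p s t₁ s₁) (hl : Runs (.loop i p) s₁ t₂ s₂) :
      Runs (.loop i p) s (1 + t₁ + t₂) s₂
  | loop_false {i : ℕ} {p : Program} {s : State}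
      (hi : s.reg i = 0) : Runs (.loop i p) s 1 s

/-- The machine is deterministic: the final state and the running time are determined by the program
and the initial state. -/
theorem Runs.deterministic {p : Program} {s s₁ s₂ : State} {t₁ t₂ : ℕ}
    (h₁ : Runs p s t₁ s₁) (h₂ : Runs p s t₂ s₂) : t₁ = t₂ ∧ s₁ = s₂ := by
  induction h₁ generalizing t₂ s₂ with
  | seq hp hq ihp ihq =>
    cases h₂ with
    | seq hp' hq' =>
      obtain ⟨rfl, rfl⟩ := ihp hp'
      obtain ⟨rfl, rfl⟩ := ihq hq'
      exact ⟨rfl, rfl⟩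
  | cond_true hi hp ih =>
    cases h₂ with
    | cond_true _ hp' => obtain ⟨rfl, rfl⟩ := ih hp'; exact ⟨rfl, rfl⟩
    | cond_false hi' _ => exact absurd hi' hi
  | cond_false hi hq ih =>
    cases h₂ with
    | cond_true hi' _ => exact absurd hi hi'
    | cond_false _ hq' => obtain ⟨rfl, rfl⟩ := ih hq'; exact ⟨rfl, rfl⟩
  | loop_true hi hp hl ihp ihl =>
    cases h₂ with
    | loop_true _ hp' hl' =>
      obtain ⟨rfl, rfl⟩ := ihp hp'
      obtain ⟨rfl, rfl⟩ := ihl hl'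
      exact ⟨rfl, rfl⟩
    | loop_false hi' => exact absurd hi' hi
  | loop_false hi =>
    cases h₂ with
    | loop_true hi' _ _ => exact absurd hi hi'
    | loop_false _ => exact ⟨rfl, rfl⟩
  | _ => cases h₂; exact ⟨rfl, rfl⟩

open Classical in
/-- The initial state for the input graph `G` with vertices `0, …, n - 1`: the register `R₀` holds
the number `n` of vertices, the memory cell `M[i * n + j]` holds the entry in row `i` and column `j`
of the adjacency matrix of `G`, and everything else is zero. -/
noncomputable def graphInput {n : ℕ} (G : SimpleGraph (Fin n)) : State where
  reg := fun r => if r = 0 then n else 0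
  mem := fun c => if ∃ i j : Fin n, G.Adj i j ∧ c = i.val * n + j.val then 1 else 0

/-- The graph property `L` is decidable in polynomial time: a single program halts on every input
graph `G`, within a time that is bounded by a polynomial in the order of `G`, and leaves in the
register `R₀` the answer, `1` if `G` has the property and `0` if not. -/
def PolyTimeDecidable (L : ∀ n : ℕ, SimpleGraph (Fin n) → Prop) : Prop :=
  ∃ (P : Program) (p : Polynomial ℕ), ∀ (n : ℕ) (G : SimpleGraph (Fin n)),
    ∃ (t : ℕ) (s : State), Runs P (graphInput G) t s ∧ t ≤ p.eval n ∧
      (L n G → s.reg 0 = 1) ∧ (¬ L n G → s.reg 0 = 0)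

end RAM

/-! The inequality α ≤ a always holds, since the degree sum of an independent set is at most m.
Suppose that an independent set I attains a(G). Then Hall's condition for matching the complement of
I into I fails by at most one (`card_le_card_neighbors_add_one`): exchanging a set S outside I with
its neighborhood in I would otherwise produce a set too large for its small degree sum. Hence,
unless I is everything, some vertex c outside I exists such that all other vertices outside I can be
matched into I. After deletion of the edges at c, the set C of these vertices is a vertex cover that
is matched injectively into its complement, and it has n - a - 1 elements. Conversely, a vertex
cover of that size or smaller for some c leaves at least a independent vertices. If I is everything,
then a = n, which is tested separately.

For fixed c, whether such a C exists is read off from one maximum matching of the bipartite double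
cover, in which every vertex has a left and a right copy. The edges from C to its partners, taken in
both directions, form a matching with 2|C| edges, and the edges of any matching number at most 2|C|.
By tightness, every maximum matching matches both copies of each vertex of C with vertices outside C
(`splitsMatching_of_cover`). Thus it suffices to look for an independent set I such that both
partners of every vertex outside I exist and lie in I. These are clauses with two literals, so the
question is one of reachability between literals (`splitsMatching_iff`).

The matching is computed by an auction with prices up to n + 2. A price level that no vertex has
splits the final state into a vertex cover no larger than the matching, which certifies maximality
(`hasSmallCover`). The annihilation number is found greedily by increasing degree. Both the auction
and the search for reachable literals are (n + 2)² repetitions of a round that increases a bounded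
potential unless it has finished (`eval_repeatCmd`).

The algorithm is written in a language with bounded loops only, so a polynomial time bound can be
read off the syntax of the program. Correctness is then a statement about its denotational
semantics, and one simulation theorem (`Cmd.compile_runsIn`) transfers both to the machine. -/

namespace RAM

/-! ### A structured language of bounded loops -/

/-- Names of scalar variables. -/
inductive Var : Type where
  | total | sum | ann | deg | res | c | i | j | k | r | r' | best | arg | u | ok | cnt | f
  deriving DecidableEq

/-- Names of arrays. -/
inductive Arr : Type where
  | own | mate | price | pos | neg
  deriving DecidableEq

/-- Values of variables and arrays. -/
structure Store : Type where
  /-- the scalar variables -/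
  v : Var → ℕ
  /-- the arrays -/
  a : Arr → ℕ → ℕ

/-- Assignment to a variable. -/
def Store.setV (s : Store) (x : Var) (z : ℕ) : Store :=
  { s with v := Function.update s.v x z }

/-- Assignment to an array entry. -/
def Store.setA (s : Store) (k : Arr) (i z : ℕ) : Store :=
  { s with a := Function.update s.a k (Function.update (s.a k) i z) }

@[simp] theorem Store.setV_v (s : Store) (x : Var) (z : ℕ) :
    (s.setV x z).v = Function.update s.v x z := rfl

@[simp] theorem Store.setV_a (s : Store) (x : Var) (z : ℕ) : (s.setV x z).a = s.a := rfl

@[simp] theorem Store.setA_v (s : Store) (k : Arr) (i z : ℕ) : (s.setA k i z).v = s.v := rfl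

@[simp] theorem Store.setA_a (s : Store) (k : Arr) (i z : ℕ) :
    (s.setA k i z).a = Function.update s.a k (Function.update (s.a k) i z) := rfl

/-- Expressions; `order` is the number of vertices and `adj` the adjacency matrix of the input. -/
inductive Expr : Type where
  | const (c : ℕ)
  | order
  | var (x : Var)
  | add (a b : Expr)
  | sub (a b : Expr)
  | get (k : Arr) (a : Expr)
  | adj (a b : Expr)
  | ite (a b c : Expr)

/-- Commands; `loop x c p` runs `p` with `x = n + c - 1, …, 0`, for `n` the number of vertices. -/
inductive Cmd : Type where
  | skip
  | set (x : Var) (e : Expr)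
  | put (k : Arr) (i e : Expr)
  | seq (p q : Cmd)
  | cond (e : Expr) (p q : Cmd)
  | loop (x : Var) (c : ℕ) (p : Cmd)

/-! ### Denotational semantics, loop invariants and frame rules. -/

section Semantics

variable {n : ℕ} (G : SimpleGraph (Fin n))

open Classical in
/-- The adjacency matrix, extended by zero. -/
noncomputable def adjEntry (i j : ℕ) : ℕ :=
  if ∃ (hi : i < n) (hj : j < n), G.Adj ⟨i, hi⟩ ⟨j, hj⟩ then 1 else 0

/-- The value of an expression. -/
noncomputable def Expr.eval (s : Store) : Expr → ℕ
  | .const c => c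
  | .order => n
  | .var x => s.v x
  | .add a b => a.eval s + b.eval s
  | .sub a b => a.eval s - b.eval s
  | .get k a => s.a k (a.eval s)
  | .adj a b => adjEntry G (a.eval s) (b.eval s)
  | .ite a b c => if a.eval s ≠ 0 then b.eval s else c.eval s

/-- Apply `f (m - 1)`, …, `f 0` in this order. -/
def iterDown (f : ℕ → Store → Store) : ℕ → Store → Store
  | 0, s => s
  | m + 1, s => iterDown f m (f m s)

/-- The effect of a command. -/
noncomputable def Cmd.eval : Cmd → Store → Store
  | .skip, s => s
  | .set x e, s => s.setV x (e.eval G s)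
  | .put k i e, s => s.setA k (i.eval G s) (e.eval G s)
  | .seq p q, s => q.eval (p.eval s)
  | .cond e p q, s => if e.eval G s ≠ 0 then p.eval s else q.eval s
  | .loop x c p, s => iterDown (fun m s => p.eval (s.setV x m)) (n + c) (s.setV x (n + c))

/-- The command may assign to the variable. -/
def Cmd.Writes : Cmd → Var → Prop
  | .skip, _ => False
  | .set x _, y => y = x
  | .put _ _ _, _ => False
  | .seq p q, y => p.Writes y ∨ q.Writes y
  | .cond _ p q, y => p.Writes y ∨ q.Writes y
  | .loop x _ p, y => y = x ∨ p.Writes y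

/-- The command may assign to the array. -/
def Cmd.WritesArr : Cmd → Arr → Prop
  | .skip, _ => False
  | .set _ _, _ => False
  | .put k _ _, l => l = k
  | .seq p q, l => p.WritesArr l ∨ q.WritesArr l
  | .cond _ p q, l => p.WritesArr l ∨ q.WritesArr l
  | .loop _ _ p, l => p.WritesArr l

/-- No loop assigns to its own counter. -/
def Cmd.WF : Cmd → Prop
  | .skip => True
  | .set _ _ => True
  | .put _ _ _ => True
  | .seq p q => p.WF ∧ q.WF
  | .cond _ p q => p.WF ∧ q.WF
  | .loop x _ p => ¬ p.Writes x ∧ p.WF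

theorem iterDown_induction {f : ℕ → Store → Store} (I : ℕ → Store → Prop) {m : ℕ} {s : Store}
    (h₀ : I m s) (hs : ∀ k < m, ∀ s, I (k + 1) s → I k (f k s)) : I 0 (iterDown f m s) := by
  induction m generalizing s with
  | zero => exact h₀
  | succ m ih => exact ih (hs m (by omega) s h₀) fun k hk => hs k (by omega)

theorem Cmd.eval_loop_induction {x : Var} {c : ℕ} {p : Cmd} {s : Store} (I : ℕ → Store → Prop)
    (h₀ : I (n + c) (s.setV x (n + c)))
    (hs : ∀ k < n + c, ∀ s, I (k + 1) s → I k (p.eval G (s.setV x k))) :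
    I 0 ((Cmd.loop x c p).eval G s) :=
  iterDown_induction I h₀ hs

theorem Cmd.eval_v_of_not_writes {p : Cmd} {x : Var} (h : ¬ p.Writes x) (s : Store) :
    (p.eval G s).v x = s.v x := by
  induction p generalizing s with
  | skip => rfl
  | set y e => simp [Cmd.Writes] at h; simp [Cmd.eval, h]
  | put => rfl
  | seq p q ihp ihq =>
    simp only [Cmd.Writes, not_or] at h
    simp [Cmd.eval, ihp h.1, ihq h.2]
  | cond e p q ihp ihq =>
    simp only [Cmd.Writes, not_or] at h
    simp only [Cmd.eval]
    split_ifs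
    exacts [ihp h.1 s, ihq h.2 s]
  | loop y c p ih =>
    simp only [Cmd.Writes, not_or] at h
    refine Cmd.eval_loop_induction G (fun _ s' => s'.v x = s.v x) (by simp [h.1]) ?_
    intro k _ s' hs'
    rw [ih h.2]
    simp [h.1, hs']

theorem Cmd.eval_a_of_not_writesArr {p : Cmd} {k : Arr} (h : ¬ p.WritesArr k) (s : Store) :
    (p.eval G s).a k = s.a k := by
  induction p generalizing s with
  | skip => rfl
  | set y e => rfl
  | put l i e => simp [Cmd.WritesArr] at h; simp [Cmd.eval, h]
  | seq p q ihp ihq =>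
    simp only [Cmd.WritesArr, not_or] at h
    simp [Cmd.eval, ihp h.1, ihq h.2]
  | cond e p q ihp ihq =>
    simp only [Cmd.WritesArr, not_or] at h
    simp only [Cmd.eval]
    split_ifs
    exacts [ihp h.1 s, ihq h.2 s]
  | loop y c p ih =>
    refine Cmd.eval_loop_induction G (fun _ s' => s'.a k = s.a k) (by simp) ?_
    intro l _ s' hs'
    rw [ih h]
    simp [hs']

/-- Induction over a loop; what the loop does not write keeps its value. -/
theorem Cmd.eval_loop_induction_frame {x : Var} {c : ℕ} {p : Cmd} {s : Store} (I : ℕ → Store → Prop)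
    (h₀ : I (n + c) (s.setV x (n + c)))
    (hs : ∀ k < n + c, ∀ s', (∀ y, ¬ (Cmd.loop x c p).Writes y → s'.v y = s.v y) →
      (∀ l, ¬ (Cmd.loop x c p).WritesArr l → s'.a l = s.a l) → I (k + 1) s' →
      I k (p.eval G (s'.setV x k))) :
    I 0 ((Cmd.loop x c p).eval G s) := by
  refine (Cmd.eval_loop_induction G (fun k s' => I k s' ∧
    (∀ y, ¬ (Cmd.loop x c p).Writes y → s'.v y = s.v y) ∧
      ∀ l, ¬ (Cmd.loop x c p).WritesArr l → s'.a l = s.a l) ⟨h₀, ?_, fun _ _ => rfl⟩ ?_).1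
  · intro y hy
    simp only [Cmd.Writes, not_or] at hy
    simp [hy.1]
  · rintro k hk s' ⟨h1, h2, h3⟩
    refine ⟨hs k hk s' h2 h3 h1, fun y hy => ?_, fun l hl => ?_⟩
    · rw [← h2 y hy]
      simp only [Cmd.Writes, not_or] at hy
      rw [Cmd.eval_v_of_not_writes G hy.2]
      simp [hy.1]
    · exact (Cmd.eval_a_of_not_writesArr G (p := p) hl _).trans (h3 l hl)

end Semantics

/-! ### Compilation to the machine

Register `0` holds `n`, register `2` holds `n * n`, register `4` holds `1`, the variables are kept in
the odd registers, and the even registers from `6` on are temporary. The arrays are interleaved in the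
memory above the adjacency matrix. -/

/-- The register of a variable. -/
def Var.reg (x : Var) : ℕ := 2 * x.ctorIdx + 1

/-- The offset of an array. -/
def Arr.offset (k : Arr) : ℕ := k.ctorIdx

theorem Var.reg_injective : Function.Injective Var.reg := by
  intro x y h
  have : x.ctorIdx = y.ctorIdx := by simp only [Var.reg] at h; omega
  revert this
  cases x <;> cases y <;> simp [Var.ctorIdx]

theorem Arr.offset_injective : Function.Injective Arr.offset := by
  intro x y h
  revert h
  cases x <;> cases y <;> simp [Arr.offset, Arr.ctorIdx]

/-- Entries of one array are 8 cells apart, a distance that three doublings produce without a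
multiplication instruction. Offsets below 8 therefore keep different arrays disjoint. -/
theorem Arr.offset_lt (k : Arr) : k.offset < 8 := by
  cases k <;> simp [Arr.offset, Arr.ctorIdx]

/-- The temporary registers. -/
def tmp (d : ℕ) : ℕ := 2 * d + 6

/-- Turn the index in the temporary register `d` into the address of an array entry. -/
def addressOf (d : ℕ) (k : Arr) : Program :=
  .seq (.add (tmp d) (tmp d) (tmp d)) <| .seq (.add (tmp d) (tmp d) (tmp d)) <|
  .seq (.add (tmp d) (tmp d) (tmp d)) <| .seq (.add (tmp d) (tmp d) 2) <|
  .seq (.const (tmp (d + 1)) k.offset) (.add (tmp d) (tmp d) (tmp (d + 1)))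

/-- Evaluate an expression into the temporary register `d`. -/
def Expr.compile : Expr → ℕ → Program
  | .const c, d => .const (tmp d) c
  | .order, d => .copy (tmp d) 0
  | .var x, d => .copy (tmp d) x.reg
  | .add a b, d => .seq (a.compile d) (.seq (b.compile (d + 1))
      (.add (tmp d) (tmp d) (tmp (d + 1))))
  | .sub a b, d => .seq (a.compile d) (.seq (b.compile (d + 1))
      (.sub (tmp d) (tmp d) (tmp (d + 1))))
  | .get k a, d => .seq (a.compile d) (.seq (addressOf d k) (.load (tmp d) (tmp d)))
  | .adj a b, d => .seq (a.compile d) <| .seq (b.compile (d + 1)) <|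
      .seq (.sub (tmp (d + 2)) 0 (tmp d)) <|
      .cond (tmp (d + 2))
        (.seq (.sub (tmp (d + 2)) 0 (tmp (d + 1))) <|
          .cond (tmp (d + 2))
            (.seq (.loop (tmp d) (.seq (.sub (tmp d) (tmp d) 4)
              (.add (tmp (d + 1)) (tmp (d + 1)) 0))) (.load (tmp d) (tmp (d + 1))))
            (.const (tmp d) 0))
        (.const (tmp d) 0)
  | .ite a b c, d => .seq (a.compile d) (.cond (tmp d) (b.compile d) (c.compile d))

/-- Translate a command. -/
def Cmd.compile : Cmd → Program
  | .skip => .skip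
  | .set x e => .seq (e.compile 0) (.copy x.reg (tmp 0))
  | .put k i e => .seq (i.compile 0) (.seq (addressOf 0 k) (.seq (e.compile 1)
      (.store (tmp 0) (tmp 1))))
  | .seq p q => .seq p.compile q.compile
  | .cond e p q => .seq (e.compile 0) (.cond (tmp 0) p.compile q.compile)
  | .loop x c p => .seq (.const (tmp 0) c) <| .seq (.add x.reg 0 (tmp 0)) <|
      .loop x.reg (.seq (.sub x.reg x.reg 4) p.compile)

open Polynomial in
/-- A bound for the running time of a compiled expression. -/
noncomputable def Expr.cost : Expr → Polynomial ℕ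
  | .const _ => 1
  | .order => 1
  | .var _ => 1
  | .add a b => a.cost + b.cost + 1
  | .sub a b => a.cost + b.cost + 1
  | .get _ a => a.cost + 7
  | .adj a b => a.cost + b.cost + 3 * X + 6
  | .ite a b c => a.cost + b.cost + c.cost + 1

open Polynomial in
/-- A bound for the running time of a compiled command. -/
noncomputable def Cmd.cost : Cmd → Polynomial ℕ
  | .skip => 1
  | .set _ e => e.cost + 1
  | .put _ i e => i.cost + e.cost + 7
  | .seq p q => p.cost + q.cost
  | .cond e p q => e.cost + p.cost + q.cost + 1
  | .loop _ c p => (X + (c : Polynomial ℕ)) * (p.cost + 2) + 3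

/-! ### Correctness and running time of the compiler. -/

section Simulation

variable {n : ℕ} (G : SimpleGraph (Fin n))

/-- The machine state represents the store. -/
structure Represents (st : Store) (s : State) : Prop where
  var : ∀ x : Var, s.reg x.reg = st.v x
  arr : ∀ k i, s.mem (8 * i + n * n + k.offset) = st.a k i
  inp : ∀ c < n * n, s.mem c = (graphInput G).mem c
  order : s.reg 0 = n
  base : s.reg 2 = n * n
  one : s.reg 4 = 1

/-- `p` runs from `s` to `s'` in time at most `T`. -/
def RunsIn (p : Program) (s : State) (T : ℕ) (s' : State) : Prop :=
  ∃ t ≤ T, Runs p s t s'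

variable {G}

theorem RunsIn.seq {p q : Program} {s s₁ s₂ : State} {T₁ T₂ : ℕ} (hp : RunsIn p s T₁ s₁)
    (hq : RunsIn q s₁ T₂ s₂) : RunsIn (.seq p q) s (T₁ + T₂) s₂ := by
  obtain ⟨t₁, h₁, hp⟩ := hp
  obtain ⟨t₂, h₂, hq⟩ := hq
  exact ⟨_, Nat.add_le_add h₁ h₂, hp.seq hq⟩

theorem RunsIn.mono {p : Program} {s s' : State} {T T' : ℕ} (h : RunsIn p s T s') (hT : T ≤ T') :
    RunsIn p s T' s' := by
  obtain ⟨t, ht, h⟩ := h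
  exact ⟨t, ht.trans hT, h⟩

theorem Runs.runsIn {p : Program} {s s' : State} {t : ℕ} (h : Runs p s t s') : RunsIn p s t s' :=
  ⟨t, le_rfl, h⟩

theorem RunsIn.cond {i : ℕ} {p q : Program} {s s' : State} {T : ℕ}
    (h₁ : s.reg i ≠ 0 → RunsIn p s T s') (h₂ : s.reg i = 0 → RunsIn q s T s') :
    RunsIn (.cond i p q) s (1 + T) s' := by
  by_cases h : s.reg i = 0
  · obtain ⟨t, ht, h'⟩ := h₂ h
    exact ⟨_, Nat.add_le_add_left ht 1, .cond_false h h'⟩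
  · obtain ⟨t, ht, h'⟩ := h₁ h
    exact ⟨_, Nat.add_le_add_left ht 1, .cond_true h h'⟩

theorem RunsIn.cond_true {i : ℕ} {p q : Program} {s s' : State} {T : ℕ} (h : s.reg i ≠ 0)
    (hp : RunsIn p s T s') : RunsIn (.cond i p q) s (1 + T) s' :=
  .cond (fun _ => hp) fun h' => absurd h' h

theorem RunsIn.cond_false {i : ℕ} {p q : Program} {s s' : State} {T : ℕ} (h : s.reg i = 0)
    (hq : RunsIn q s T s') : RunsIn (.cond i p q) s (1 + T) s' :=
  .cond (fun h' => absurd h h') fun _ => hq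

/-- `s'` differs from `s` in the temporary registers from `d` on only. -/
structure AgreesBelow (d : ℕ) (s s' : State) : Prop where
  reg : ∀ r, (∀ e, d ≤ e → r ≠ tmp e) → s'.reg r = s.reg r
  mem : s'.mem = s.mem

theorem AgreesBelow.trans {d d₁ d₂ : ℕ} {s s₁ s₂ : State} (h₁ : AgreesBelow d₁ s s₁)
    (h₂ : AgreesBelow d₂ s₁ s₂) (hd₁ : d ≤ d₁) (hd₂ : d ≤ d₂) : AgreesBelow d s s₂ where
  reg r hr := (h₂.reg r fun e he => hr e (hd₂.trans he)).trans
    (h₁.reg r fun e he => hr e (hd₁.trans he))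
  mem := h₂.mem.trans h₁.mem

theorem AgreesBelow.setReg {d e : ℕ} {s s' : State} (h : AgreesBelow d s s') (he : d ≤ e) (x : ℕ) :
    AgreesBelow d s (s'.setReg (tmp e) x) where
  reg r hr := by simp [State.setReg, hr e he, h.reg r hr]
  mem := h.mem

theorem AgreesBelow.refl (d : ℕ) (s : State) : AgreesBelow d s s := ⟨fun _ _ => rfl, rfl⟩

theorem AgreesBelow.tmp_eq {d e : ℕ} {s s' : State} (h : AgreesBelow d s s') (he : e < d) :
    s'.reg (tmp e) = s.reg (tmp e) :=
  h.reg _ fun e' he' => by simp only [tmp]; omega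

theorem Represents.of_agreesBelow {d : ℕ} {st : Store} {s s' : State} (h : Represents G st s)
    (h' : AgreesBelow d s s') : Represents G st s' where
  var x := by rw [h'.reg _ fun e _ => by simp only [Var.reg, tmp]; omega, h.var]
  arr k i := by rw [h'.mem, h.arr]
  inp c hc := by rw [h'.mem, h.inp c hc]
  order := by rw [h'.reg _ fun e _ => by simp only [tmp]; omega, h.order]
  base := by rw [h'.reg _ fun e _ => by simp only [tmp]; omega, h.base]
  one := by rw [h'.reg _ fun e _ => by simp only [tmp]; omega, h.one]

theorem addressOf_runsIn {st : Store} {s : State} (hs : Represents G st s) (d : ℕ) (k : Arr) :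
    ∃ s', RunsIn (addressOf d k) s 6 s' ∧
      s'.reg (tmp d) = 8 * s.reg (tmp d) + n * n + k.offset ∧ AgreesBelow d s s' := by
  have hb := hs.base
  refine ⟨_, (Runs.add ..).runsIn.seq <| (Runs.add ..).runsIn.seq <| (Runs.add ..).runsIn.seq <|
    (Runs.add ..).runsIn.seq <| (Runs.const ..).runsIn.seq (Runs.add ..).runsIn, ?_, ?_⟩
  · simp [State.setReg, tmp, hb]
    omega
  · exact (((((((AgreesBelow.refl d s).setReg le_rfl _).setReg le_rfl _).setReg le_rfl _).setReg
      le_rfl _).setReg (Nat.le_succ d) _).setReg le_rfl _)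

theorem graphInput_mem_mul_add (i j : ℕ) (hi : i < n) (hj : j < n) :
    (graphInput G).mem (i * n + j) = adjEntry G i j := by
  have key : (∃ i' j' : Fin n, G.Adj i' j' ∧ i * n + j = i'.val * n + j'.val) ↔
      ∃ (hi : i < n) (hj : j < n), G.Adj ⟨i, hi⟩ ⟨j, hj⟩ := by
    constructor
    · rintro ⟨i', j', h, he⟩
      have h1 : j = j' := by
        have := congrArg (· % n) he
        simpa [Nat.add_mod, Nat.mod_eq_of_lt hj, Nat.mod_eq_of_lt j'.2] using this
      have h2 : i = i' := by
        subst h1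
        exact Nat.eq_of_mul_eq_mul_right (by omega) (Nat.add_right_cancel he)
      subst h1 h2
      exact ⟨hi, hj, h⟩
    · rintro ⟨hi, hj, h⟩
      exact ⟨_, _, h, rfl⟩
  unfold graphInput adjEntry
  classical
  exact if_congr key rfl rfl

/-- The arrays live above the adjacency matrix, so the input state already represents arrays filled
with zeros. -/
theorem graphInput_mem_eq_zero {c : ℕ} (hc : n * n ≤ c) : (graphInput G).mem c = 0 := by
  simp only [graphInput, ite_eq_right_iff, one_ne_zero, imp_false, not_exists, not_and]
  rintro i j - rfl
  have := Nat.mul_le_mul_right n (Nat.succ_le_of_lt i.2)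
  have := j.2
  simp only [Nat.succ_mul] at *
  omega

/-- Repeated addition of register `0`. -/
theorem runsIn_mul_loop {x y : ℕ} (hxy : x ≠ y) (hx : x ≠ 4) (hy : y ≠ 4) (hx0 : x ≠ 0) (hy0 : y ≠ 0)
    (s : State) (h1 : s.reg 4 = 1) :
    ∃ s', RunsIn (.loop x (.seq (.sub x x 4) (.add y y 0))) s (3 * s.reg x + 1) s' ∧
      s'.reg y = s.reg x * s.reg 0 + s.reg y ∧ s'.mem = s.mem ∧
      ∀ r, r ≠ x → r ≠ y → s'.reg r = s.reg r := by
  generalize hm : s.reg x = m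
  induction m generalizing s with
  | zero => exact ⟨s, (Runs.loop_false hm).runsIn, by simp, rfl, fun _ _ _ => rfl⟩
  | succ m ih =>
    obtain ⟨s', ⟨t, ht, hrun⟩, h2, h3, h4⟩ :=
      ih ((s.setReg x (s.reg x - s.reg 4)).setReg y
        ((s.setReg x (s.reg x - s.reg 4)).reg y + (s.setReg x (s.reg x - s.reg 4)).reg 0))
        (by simp [State.setReg, hx.symm, hy.symm, h1]) (by simp [State.setReg, hxy, h1, hm])
    refine ⟨s', ⟨1 + (1 + 1) + t, by omega, .loop_true (by omega) ((Runs.sub ..).seq (.add ..)) hrun⟩,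
      ?_, ?_, ?_⟩
    · rw [h2]
      simp [State.setReg, hxy.symm, hx0.symm, hy0.symm]
      ring
    · rw [h3]; rfl
    · intro r hrx hry
      rw [h4 r hrx hry]
      simp [State.setReg, hrx, hry]

/-- The temporary registers act as a stack: evaluation at depth `d` leaves those below `d` alone, so
the first operand in `tmp d` survives the evaluation of the second at depth `d + 1`. -/
theorem Expr.compile_runsIn (e : Expr) (d : ℕ) {st : Store} {s : State} (hs : Represents G st s) :
    ∃ s', RunsIn (e.compile d) s (e.cost.eval n) s' ∧ s'.reg (tmp d) = e.eval G st ∧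
      AgreesBelow d s s' := by
  have hself : ∀ (s : State) d x, (s.setReg (tmp d) x).reg (tmp d) = x := by simp [State.setReg]
  induction e generalizing d s with
  | const c =>
    exact ⟨_, by simpa [cost, compile] using (Runs.const ..).runsIn, by simp [State.setReg, eval],
      (AgreesBelow.refl d s).setReg le_rfl _⟩
  | order =>
    exact ⟨_, by simpa [cost, compile] using (Runs.copy ..).runsIn,
      by simp [State.setReg, eval, hs.order], (AgreesBelow.refl d s).setReg le_rfl _⟩
  | var x =>
    exact ⟨_, by simpa [cost, compile] using (Runs.copy ..).runsIn,
      by simp [State.setReg, eval, hs.var], (AgreesBelow.refl d s).setReg le_rfl _⟩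
  | add a b iha ihb =>
    obtain ⟨s₁, r₁, v₁, g₁⟩ := iha d hs
    obtain ⟨s₂, r₂, v₂, g₂⟩ := ihb (d + 1) (hs.of_agreesBelow g₁)
    refine ⟨_, (r₁.seq (r₂.seq (Runs.add ..).runsIn)).mono ?_, ?_,
      (g₁.trans g₂ le_rfl (Nat.le_succ d)).setReg le_rfl _⟩
    · simp [cost]; omega
    · rw [hself, g₂.tmp_eq (Nat.lt_succ_self d), v₁, v₂, eval]
  | sub a b iha ihb =>
    obtain ⟨s₁, r₁, v₁, g₁⟩ := iha d hs
    obtain ⟨s₂, r₂, v₂, g₂⟩ := ihb (d + 1) (hs.of_agreesBelow g₁)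
    refine ⟨_, (r₁.seq (r₂.seq (Runs.sub ..).runsIn)).mono ?_, ?_,
      (g₁.trans g₂ le_rfl (Nat.le_succ d)).setReg le_rfl _⟩
    · simp [cost]; omega
    · rw [hself, g₂.tmp_eq (Nat.lt_succ_self d), v₁, v₂, eval]
  | get k a iha =>
    obtain ⟨s₁, r₁, v₁, g₁⟩ := iha d hs
    obtain ⟨s₂, r₂, v₂, g₂⟩ := addressOf_runsIn (hs.of_agreesBelow g₁) d k
    refine ⟨_, (r₁.seq (r₂.seq (Runs.load ..).runsIn)).mono ?_, ?_,
      (g₁.trans g₂ le_rfl le_rfl).setReg le_rfl _⟩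
    · simp [cost]
    · rw [hself, v₂, v₁, ((hs.of_agreesBelow g₁).of_agreesBelow g₂).arr, eval]
  | ite a b c iha ihb ihc =>
    obtain ⟨s₁, r₁, v₁, g₁⟩ := iha d hs
    have hs₁ := hs.of_agreesBelow g₁
    by_cases h : a.eval G st = 0
    · obtain ⟨s₂, r₂, v₂, g₂⟩ := ihc d hs₁
      refine ⟨s₂, (r₁.seq (RunsIn.cond_false (v₁.trans h) r₂)).mono ?_, ?_,
        g₁.trans g₂ le_rfl le_rfl⟩
      · simp [cost]; omega
      · simp [v₂, eval, h]
    · obtain ⟨s₂, r₂, v₂, g₂⟩ := ihb d hs₁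
      refine ⟨s₂, (r₁.seq (RunsIn.cond_true (by rwa [v₁]) r₂)).mono ?_, ?_,
        g₁.trans g₂ le_rfl le_rfl⟩
      · simp [cost]; omega
      · simp [v₂, eval, h]
  | adj a b iha ihb =>
    obtain ⟨s₁, r₁, v₁, g₁⟩ := iha d hs
    obtain ⟨s₂, r₂, v₂, g₂⟩ := ihb (d + 1) (hs.of_agreesBelow g₁)
    have g₁₂ := g₁.trans g₂ le_rfl (Nat.le_succ d)
    have hs₂ := hs.of_agreesBelow g₁₂
    have v₁' : s₂.reg (tmp d) = a.eval G st := by rw [g₂.tmp_eq (Nat.lt_succ_self d), v₁]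
    have e1 : tmp (d + 1) ≠ tmp (d + 2) := by simp [tmp]
    have e2 : tmp d ≠ tmp (d + 2) := by simp [tmp]
    have e3 : tmp d ≠ tmp (d + 1) := by simp [tmp]
    have e4 : (0 : ℕ) ≠ tmp (d + 2) := by simp [tmp]
    have g₃ := g₁₂.setReg (show d ≤ d + 2 by omega) (s₂.reg 0 - s₂.reg (tmp d))
    set s₃ := s₂.setReg (tmp (d + 2)) (s₂.reg 0 - s₂.reg (tmp d)) with hs₃
    have hc₃ : s₃.reg (tmp (d + 2)) = n - a.eval G st := by
      simp [hs₃, State.setReg, v₁', hs₂.order]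
    -- An index outside the matrix must give 0 without a memory access, because the cell at the
    -- computed address may belong to another row or to an array.
    by_cases ha : n - a.eval G st = 0
    · refine ⟨_, (r₁.seq <| r₂.seq <| (Runs.sub ..).runsIn.seq <|
        RunsIn.cond_false (hc₃.trans ha) (Runs.const ..).runsIn).mono ?_, ?_, g₃.setReg le_rfl _⟩
      · simp [cost]; omega
      · rw [hself, eval, adjEntry, if_neg]
        rintro ⟨hi, -⟩
        omega
    have g₄ := g₃.setReg (show d ≤ d + 2 by omega) (s₃.reg 0 - s₃.reg (tmp (d + 1)))
    set s₄ := s₃.setReg (tmp (d + 2)) (s₃.reg 0 - s₃.reg (tmp (d + 1))) with hs₄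
    have hc₄ : s₄.reg (tmp (d + 2)) = n - b.eval G st := by
      simp [hs₄, hs₃, State.setReg, v₂, hs₂.order, e1, e4]
    by_cases hb : n - b.eval G st = 0
    · refine ⟨_, (r₁.seq <| r₂.seq <| (Runs.sub ..).runsIn.seq <|
        RunsIn.cond_true (by rwa [hc₃]) <| (Runs.sub ..).runsIn.seq <|
        RunsIn.cond_false (hc₄.trans hb) (Runs.const ..).runsIn).mono ?_, ?_, g₄.setReg le_rfl _⟩
      · simp [cost]; omega
      · rw [hself, eval, adjEntry, if_neg]
        rintro ⟨-, hj, -⟩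
        omega
    have hs₄' := hs.of_agreesBelow g₄
    obtain ⟨s₅, r₅, v₅, m₅, f₅⟩ := runsIn_mul_loop (x := tmp d) (y := tmp (d + 1)) e3
      (by simp only [tmp]; omega) (by simp only [tmp]; omega) (by simp [tmp]) (by simp [tmp]) s₄ hs₄'.one
    have ha₄ : s₄.reg (tmp d) = a.eval G st := by
      simp [hs₄, hs₃, State.setReg, v₁', e2]
    have hb₄ : s₄.reg (tmp (d + 1)) = b.eval G st := by
      simp [hs₄, hs₃, State.setReg, v₂, e1]
    have g₅ : AgreesBelow d s s₅ := by
      refine g₄.trans (d₂ := d) ⟨fun r hr => f₅ r (hr d le_rfl) (hr _ (Nat.le_succ d)), m₅⟩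
        le_rfl le_rfl
    refine ⟨_, (r₁.seq <| r₂.seq <| (Runs.sub ..).runsIn.seq <|
        RunsIn.cond_true (by rwa [hc₃]) <| (Runs.sub ..).runsIn.seq <|
        RunsIn.cond_true (by rwa [hc₄]) <| r₅.seq (Runs.load ..).runsIn).mono ?_, ?_,
        g₅.setReg le_rfl _⟩
    · rw [ha₄]; simp [cost]; omega
    · rw [hself, v₅, m₅, ha₄, hb₄, hs₄'.order, hs₄'.inp, graphInput_mem_mul_add _ _ (by omega)
        (by omega), eval]
      have := Nat.mul_le_mul_right n (show a.eval G st + 1 ≤ n by omega)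
      rw [Nat.succ_mul] at this
      omega

theorem Represents.setVar {st : Store} {s : State} (h : Represents G st s) (x : Var) (z : ℕ) :
    Represents G (st.setV x z) (s.setReg x.reg z) where
  var y := by
    by_cases hy : y = x
    · subst hy; simp [State.setReg]
    · simp [State.setReg, hy, Var.reg_injective.ne hy, h.var]
  arr k i := h.arr k i
  inp c hc := h.inp c hc
  order := by
    have : 0 ≠ x.reg := by simp only [Var.reg]; omega
    simp [State.setReg, this, h.order]
  base := by
    have : 2 ≠ x.reg := by simp only [Var.reg]; omega
    simp [State.setReg, this, h.base]
  one := by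
    have : 4 ≠ x.reg := by simp only [Var.reg]; omega
    simp [State.setReg, this, h.one]

theorem Represents.setArr {st : Store} {s : State} (h : Represents G st s) (k : Arr) (i z : ℕ) :
    Represents G (st.setA k i z) (s.setMem (8 * i + n * n + k.offset) z) where
  var y := h.var y
  arr l j := by
    by_cases hl : l = k
    · subst hl
      by_cases hj : j = i
      · subst hj; simp [State.setMem]
      · have : 8 * j + n * n + l.offset ≠ 8 * i + n * n + l.offset := by omega
        simp [State.setMem, hj, h.arr]
    · have : 8 * j + n * n + l.offset ≠ 8 * i + n * n + k.offset := by
        have := Arr.offset_injective.ne hl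
        have := l.offset_lt
        have := k.offset_lt
        omega
      simp [State.setMem, hl, this, h.arr]
  inp c hc := by
    exact (Function.update_of_ne (by omega) _ _).trans (h.inp c hc)
  order := h.order
  base := h.base
  one := h.one

/-- The only delicate case is the loop. The semantics resets the counter before each pass, whereas
the machine merely decrements its register; the two agree because the body does not assign to the
counter. -/
theorem Cmd.compile_runsIn {p : Cmd} (hp : p.WF) {st : Store} {s : State}
    (hs : Represents G st s) :
    ∃ s', RunsIn p.compile s (p.cost.eval n) s' ∧ Represents G (p.eval G st) s' := by
  induction p generalizing st s with
  | skip => exact ⟨s, by simpa [cost, compile] using (Runs.skip s).runsIn, hs⟩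
  | set x e =>
    obtain ⟨s₁, r₁, v₁, g₁⟩ := e.compile_runsIn 0 hs
    refine ⟨_, (r₁.seq (Runs.copy ..).runsIn).mono (by simp [cost]), ?_⟩
    rw [v₁]
    exact (hs.of_agreesBelow g₁).setVar x _
  | put k i e =>
    obtain ⟨s₁, r₁, v₁, g₁⟩ := i.compile_runsIn 0 hs
    obtain ⟨s₂, r₂, v₂, g₂⟩ := addressOf_runsIn (hs.of_agreesBelow g₁) 0 k
    have hs₂ := (hs.of_agreesBelow g₁).of_agreesBelow g₂
    obtain ⟨s₃, r₃, v₃, g₃⟩ := e.compile_runsIn 1 hs₂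
    refine ⟨_, (r₁.seq (r₂.seq (r₃.seq (Runs.store ..).runsIn))).mono ?_, ?_⟩
    · simp [cost]; omega
    · rw [v₃, g₃.tmp_eq one_pos, v₂, v₁]
      exact (hs₂.of_agreesBelow g₃).setArr k _ _
  | seq p q ihp ihq =>
    obtain ⟨s₁, r₁, h₁⟩ := ihp hp.1 hs
    obtain ⟨s₂, r₂, h₂⟩ := ihq hp.2 h₁
    exact ⟨s₂, (r₁.seq r₂).mono (by simp [cost]), h₂⟩
  | cond e p q ihp ihq =>
    obtain ⟨s₁, r₁, v₁, g₁⟩ := e.compile_runsIn 0 hs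
    by_cases h : e.eval G st = 0
    · obtain ⟨s₂, r₂, h₂⟩ := ihq hp.2 (hs.of_agreesBelow g₁)
      refine ⟨s₂, (r₁.seq (RunsIn.cond_false (v₁.trans h) r₂)).mono ?_, by simpa [eval, h]⟩
      simp [cost]; omega
    · obtain ⟨s₂, r₂, h₂⟩ := ihp hp.1 (hs.of_agreesBelow g₁)
      refine ⟨s₂, (r₁.seq (RunsIn.cond_true (by rwa [v₁]) r₂)).mono ?_, by simpa [eval, h]⟩
      simp [cost]; omega
  | loop x c p ih =>
    -- Each pass costs two units besides the body, for the test and the decrement, and the final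
    -- failing test costs one more.
    have run : ∀ m (st : Store) (s : State), Represents G st s → st.v x = m →
        ∃ s', RunsIn (.loop x.reg (.seq (.sub x.reg x.reg 4) p.compile)) s
          (m * (p.cost.eval n + 2) + 1) s' ∧
          Represents G (iterDown (fun m s => p.eval G (s.setV x m)) m st) s' := by
      intro m
      induction m with
      | zero =>
        intro st s hs hm
        exact ⟨s, by simpa using (Runs.loop_false (by rw [hs.var, hm])).runsIn, hs⟩
      | succ m ihm =>
        intro st s hs hm
        have h₁ := hs.setVar x m
        obtain ⟨s₂, ⟨t₂, ht₂, r₂⟩, h₂⟩ := ih hp.2 h₁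
        obtain ⟨s₃, ⟨t₃, ht₃, r₃⟩, h₃⟩ := ihm _ s₂ h₂
          (by rw [Cmd.eval_v_of_not_writes G hp.1]; simp)
        refine ⟨s₃, ⟨1 + (1 + t₂) + t₃, ?_, .loop_true (by rw [hs.var, hm]; omega)
          (.seq (.sub s x.reg x.reg 4) ?_) r₃⟩, h₃⟩
        · rw [Nat.succ_mul]; omega
        · rwa [hs.var, hm, hs.one]
    have g₁ := (AgreesBelow.refl 0 s).setReg (Nat.zero_le 0) c
    have h₁ := hs.of_agreesBelow g₁
    obtain ⟨s₂, r₂, h₂⟩ := run (n + c) _ _ (h₁.setVar x (n + c)) (by simp)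
    refine ⟨s₂, ((Runs.const ..).runsIn.seq ((Runs.add ..).runsIn.seq
      (T₂ := (n + c) * (p.cost.eval n + 2) + 1) ?_)).mono ?_, h₂⟩
    · have e : (s.setReg (tmp 0) c).reg (tmp 0) = c := by simp [State.setReg]
      rw [e, h₁.order]
      exact r₂
    · simp [cost]; omega

/-- The machine program of a command: initialize the constants, run the command, and output the
value of a variable. -/
def Cmd.program (p : Cmd) (x : Var) : Program :=
  .seq (.const 4 1) <| .seq (.copy 6 0) <|
  .seq (.loop 6 (.seq (.sub 6 6 4) (.add 2 2 0))) <| .seq p.compile (.copy 0 x.reg)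

variable (G) in
open Polynomial in
-- The extra `3 * X + 4` pays for the two initial assignments, the computation of `n * n` by
-- repeated addition, and the final copy of the answer.
theorem Cmd.program_runsIn {p : Cmd} (hp : p.WF) (x : Var) :
    ∃ s', RunsIn (p.program x) (graphInput G) ((p.cost + 3 * X + 4).eval n) s' ∧
      s'.reg 0 = (p.eval G ⟨fun _ => 0, fun _ _ => 0⟩).v x := by
  set s₀ := graphInput G
  set s₁ := s₀.setReg 4 1
  set s₂ := s₁.setReg 6 (s₁.reg 0)
  have hr : ∀ r, s₀.reg r = if r = 0 then n else 0 := fun _ => rfl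
  obtain ⟨s₃, r₃, v₃, m₃, f₃⟩ := runsIn_mul_loop (x := 6) (y := 2) (by omega) (by omega) (by omega)
    (by omega) (by omega) s₂ (by simp [s₂, s₁, State.setReg])
  have h₃ : Represents G ⟨fun _ => 0, fun _ _ => 0⟩ s₃ := by
    refine ⟨fun x => ?_, fun k i => ?_, fun c _ => by rw [m₃]; rfl, ?_, ?_, ?_⟩
    · rw [f₃ _ (by simp only [Var.reg]; omega) (by simp only [Var.reg]; omega)]
      have h1 : x.reg ≠ 6 := by simp only [Var.reg]; omega
      have h2 : x.reg ≠ 4 := by simp only [Var.reg]; omega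
      have h3 : x.reg ≠ 0 := by simp only [Var.reg]; omega
      simp [s₂, s₁, State.setReg, h1, h2, h3, hr]
    · rw [m₃]
      exact graphInput_mem_eq_zero (by omega)
    · rw [f₃ 0 (by omega) (by omega)]
      simp [s₂, s₁, State.setReg, hr]
    · rw [v₃]
      simp [s₂, s₁, State.setReg, hr]
    · rw [f₃ 4 (by omega) (by omega)]
      simp [s₂, s₁, State.setReg]
  obtain ⟨s₄, r₄, h₄⟩ := Cmd.compile_runsIn hp h₃
  refine ⟨_, ((Runs.const ..).runsIn.seq ((Runs.copy ..).runsIn.seq (r₃.seq (r₄.seq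
    (Runs.copy ..).runsIn)))).mono ?_, ?_⟩
  · have : s₂.reg 6 = n := by simp [s₂, s₁, State.setReg, hr]
    rw [this]
    simp
    omega
  · simp [State.setReg, h₄.var]

end Simulation

end RAM

open Relation Finset

/-! ### Two-satisfiability -/

/-- A set of implications between literals that is closed under contraposition has a satisfying
assignment unless some literal and its negation imply each other. -/
theorem exists_assignment_of_implications {R : Bool × ℕ → Bool × ℕ → Prop}
    (hR : ∀ b u b' v, R (b, u) (b', v) → R (!b', v) (!b, u)) (n : ℕ)
    (h : ∀ u < n, ¬ (ReflTransGen R (true, u) (false, u) ∧ ReflTransGen R (false, u) (true, u))) :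
    ∃ S : Set (Bool × ℕ), (∀ x y, x ∈ S → R x y → y ∈ S) ∧ (∀ b u, (b, u) ∈ S → (!b, u) ∉ S) ∧
      ∀ u < n, (true, u) ∈ S ∨ (false, u) ∈ S := by
  have contra : ∀ x y : Bool × ℕ, ReflTransGen R x y → ReflTransGen R (!y.1, y.2) (!x.1, x.2) := by
    intro x y hxy
    induction hxy with
    | refl => exact .refl
    | tail _ h ih => exact ReflTransGen.head (hR _ _ _ _ h) ih
  have closed : ∀ S : Set (Bool × ℕ), (∀ x y, x ∈ S → R x y → y ∈ S) →
      ∀ x y, x ∈ S → ReflTransGen R x y → y ∈ S := by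
    intro S hS x y hx hxy
    induction hxy with
    | refl => exact hx
    | tail _ h ih => exact hS _ _ ih h
  induction n with
  | zero => exact ⟨∅, by simp, by simp, by simp⟩
  | succ n ih =>
    obtain ⟨S, h1, h2, h3⟩ := ih fun u hu => h u (by omega)
    by_cases hn : (true, n) ∈ S ∨ (false, n) ∈ S
    · exact ⟨S, h1, h2, fun u hu => (Nat.lt_succ_iff_lt_or_eq.1 hu).elim (h3 u) (by rintro rfl; exact hn)⟩
    -- If the variable `n` is still undecided, one of its two literals does not imply its own
    -- negation; this literal and all its consequences are added to `S`.
    obtain ⟨b, hb⟩ : ∃ b, ¬ ReflTransGen R (b, n) (!b, n) := by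
      by_contra! hc
      exact h n (by omega) ⟨hc true, hc false⟩
    have hnS : ∀ b', (b', n) ∉ S := by
      intro b'
      push Not at hn
      cases b' <;> simp [hn]
    refine ⟨S ∪ {y | ReflTransGen R (b, n) y}, ?_, ?_, ?_⟩
    · rintro x y (hx | hx) hxy
      · exact .inl (h1 x y hx hxy)
      · exact .inr (ReflTransGen.tail hx hxy)
    · have mixed : ∀ b' u, (b', u) ∈ S → ¬ ReflTransGen R (b, n) (!b', u) := by
        intro b' u hu hr
        have := contra _ _ hr
        simp only [Bool.not_not] at this
        exact hnS _ (closed S h1 _ _ hu this)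
      rintro b' u (hu | hu) (hu' | hu')
      · exact h2 b' u hu hu'
      · exact mixed b' u hu hu'
      · exact mixed _ u hu' (by simpa using hu)
      · have := contra _ _ hu'
        simp only [Bool.not_not] at this
        exact hb (hu.trans this)
    · intro u hu
      rcases Nat.lt_succ_iff_lt_or_eq.1 hu with hu | rfl
      · rcases h3 u hu with h | h
        exacts [.inl (.inl h), .inr (.inl h)]
      · cases b
        exacts [.inr (.inr .refl), .inl (.inr .refl)]

/-! ### Matchings of the bipartite double cover

A graph on `{0, …, n - 1}` is given by a relation `E`. A matching between two copies of the vertex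
set is given by functions `mate` and `own`, where `mate i = j + 1` and `own j = i + 1` if the left copy
of `i` is matched with the right copy of `j`, and the value `0` stands for an unmatched vertex. -/

/-- The functions describe a matching of the bipartite double cover of `E`. -/
structure IsDoubleMatching (n : ℕ) (E : ℕ → ℕ → Prop) (mate own : ℕ → ℕ) : Prop where
  pair : ∀ i < n, ∀ j < n, (mate i = j + 1 ↔ own j = i + 1)
  mate_le : ∀ i < n, mate i ≤ n
  own_le : ∀ j < n, own j ≤ n
  edge : ∀ i < n, ∀ j < n, mate i = j + 1 → E i j

/-- The number of edges of the matching. -/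
def matchedCount (n : ℕ) (mate : ℕ → ℕ) : ℕ := #{i ∈ range n | mate i ≠ 0}

/-- The double cover has a vertex cover that is not larger than the matching. -/
def HasSmallCover (n : ℕ) (E : ℕ → ℕ → Prop) (mate : ℕ → ℕ) : Prop :=
  ∃ W W' : Finset ℕ, (∀ i j, E i j → i ∈ W ∨ j ∈ W') ∧ #W + #W' ≤ matchedCount n mate

/-- There is an independent set `I` such that every vertex outside `I` is matched into `I` by both
functions. -/
def SplitsMatching (n : ℕ) (E : ℕ → ℕ → Prop) (mate own : ℕ → ℕ) : Prop :=
  ∃ I : Set ℕ, (∀ u v, E u v → u ∈ I → v ∉ I) ∧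
    ∀ v < n, v ∉ I → (∃ w ∈ I, w < n ∧ mate v = w + 1) ∧ ∃ w ∈ I, w < n ∧ own v = w + 1

/-- The implications between the literals `v ∈ I` (written `(true, v)`) and `v ∉ I` (written
`(false, v)`) that express that the matching splits. -/
inductive LiteralStep (n : ℕ) (E : ℕ → ℕ → Prop) (mate own : ℕ → ℕ) :
    Bool × ℕ → Bool × ℕ → Prop where
  | edge {u v : ℕ} : E u v → LiteralStep n E mate own (true, u) (false, v)
  | mate {v w : ℕ} : v < n → w < n → mate v = w + 1 → LiteralStep n E mate own (false, v) (true, w)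
  | own {v w : ℕ} : v < n → w < n → own v = w + 1 → LiteralStep n E mate own (false, v) (true, w)
  | free_mate {v : ℕ} : v < n → mate v = 0 → LiteralStep n E mate own (false, v) (true, v)
  | free_own {v : ℕ} : v < n → own v = 0 → LiteralStep n E mate own (false, v) (true, v)

/-! ### Vertex covers and maximum matchings of the double cover. -/

namespace IsDoubleMatching

variable {n : ℕ} {E : ℕ → ℕ → Prop} {mate own : ℕ → ℕ}

theorem exists_of_mate_ne_zero (hM : IsDoubleMatching n E mate own) {i : ℕ} (hi : i < n)
    (h : mate i ≠ 0) : ∃ j < n, mate i = j + 1 := by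
  have := hM.mate_le i hi
  exact ⟨mate i - 1, by omega, by omega⟩

theorem exists_of_own_ne_zero (hM : IsDoubleMatching n E mate own) {i : ℕ} (hi : i < n)
    (h : own i ≠ 0) : ∃ j < n, own i = j + 1 := by
  have := hM.own_le i hi
  exact ⟨own i - 1, by omega, by omega⟩

/-- Since `mate` and `own` are inverse to each other, the contrapositive of a `mate` implication is
an `own` implication, and conversely. The edge implications are closed under contraposition by
symmetry of `E`. For an unmatched copy of `v`, the step from `v ∉ I` to `v ∈ I` forces `v` into `I`
and is its own contrapositive. Hence the criterion for two-satisfiability applies. -/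
theorem splitsMatching_iff (hM : IsDoubleMatching n E mate own) (hE : ∀ i j, E i j → E j i) :
    SplitsMatching n E mate own ↔
      ∀ u < n, ¬ (ReflTransGen (LiteralStep n E mate own) (true, u) (false, u) ∧
        ReflTransGen (LiteralStep n E mate own) (false, u) (true, u)) := by
  constructor
  · rintro ⟨I, h1, h2⟩ u hu ⟨h3, h4⟩
    -- Truth of literals under the assignment given by `I` propagates along implications.
    have key : ∀ x y, ReflTransGen (LiteralStep n E mate own) x y → (x.1 = true ↔ x.2 ∈ I) →
        (y.1 = true ↔ y.2 ∈ I) := by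
      intro x y hxy hx
      induction hxy with
      | refl => exact hx
      | tail _ h ih =>
        cases h with
        | edge h => simpa using h1 _ _ h (by simpa using ih)
        | mate hv hw h =>
          obtain ⟨⟨w, hw, -, h'⟩, -⟩ := h2 _ hv (by simpa using ih)
          obtain rfl := Nat.succ_injective (h.symm.trans h')
          simpa using hw
        | own hv hw h =>
          obtain ⟨-, w, hw, -, h'⟩ := h2 _ hv (by simpa using ih)
          obtain rfl := Nat.succ_injective (h.symm.trans h')
          simpa using hw
        | free_mate hv h =>
          obtain ⟨⟨w, -, -, h'⟩, -⟩ := h2 _ hv (by simpa using ih)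
          omega
        | free_own hv h =>
          obtain ⟨-, w, -, -, h'⟩ := h2 _ hv (by simpa using ih)
          omega
    by_cases hI : u ∈ I
    · simpa [hI] using key _ _ h3 (by simpa using hI)
    · simpa [hI] using key _ _ h4 (by simpa using hI)
  · intro h
    obtain ⟨S, h1, h2, h3⟩ := exists_assignment_of_implications (fun b u b' v hR => by
      cases hR with
      | edge h => exact .edge (hE _ _ h)
      | mate hv hw h => exact .own hw hv ((hM.pair _ hv _ hw).1 h)
      | own hv hw h => exact .mate hw hv ((hM.pair _ hw _ hv).2 h)
      | free_mate hv h => exact .free_mate hv h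
      | free_own hv h => exact .free_own hv h) n h
    refine ⟨{u | (true, u) ∈ S}, fun u v huv hu hv => ?_, fun v hv hvS => ?_⟩
    · exact h2 _ _ hv (h1 _ _ hu (.edge huv))
    · have hf : (false, v) ∈ S := (h3 v hv).resolve_left hvS
      have hm : mate v ≠ 0 := fun h0 => hvS (h1 _ _ hf (.free_mate hv h0))
      have ho : own v ≠ 0 := fun h0 => hvS (h1 _ _ hf (.free_own hv h0))
      obtain ⟨j, hj, hmj⟩ := hM.exists_of_mate_ne_zero hv hm
      obtain ⟨k, hk, hok⟩ := hM.exists_of_own_ne_zero hv ho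
      exact ⟨⟨j, h1 _ _ hf (.mate hv hj hmj), hj, hmj⟩, k, h1 _ _ hf (.own hv hk hok), hk, hok⟩

open Classical in
-- The complement of `I` is the vertex cover. Its vertices and their partners under `own`, which lie
-- in `I`, are all matched on the left and are pairwise distinct.
theorem exists_independent_of_splitsMatching (hM : IsDoubleMatching n E mate own)
    (h : SplitsMatching n E mate own) :
    ∃ C ⊆ range n, (∀ u < n, ∀ v < n, E u v → u ∈ C ∨ v ∈ C) ∧ 2 * #C ≤ matchedCount n mate := by
  obtain ⟨I, h1, h2⟩ := h
  refine ⟨{v ∈ range n | v ∉ I}, filter_subset _ _, ?_, ?_⟩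
  · intro u hu v hv huv
    by_cases hI : u ∈ I
    · exact .inr (by simp [hv, h1 u v huv hI])
    · exact .inl (by simp [hu, hI])
  · set C : Finset ℕ := {v ∈ range n | v ∉ I} with hC
    have hown : ∀ v ∈ C, ∃ w ∈ I, w < n ∧ own v = w + 1 := fun v hv => by
      simp only [hC, mem_filter, mem_range] at hv
      exact (h2 v hv.1 hv.2).2
    have hinj : Set.InjOn (fun v => own v - 1) C := by
      intro v hv v' hv' hvv
      obtain ⟨w, -, hw, h⟩ := hown v hv
      obtain ⟨w', -, hw', h'⟩ := hown v' hv'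
      simp only [hC, coe_filter, mem_range, Set.mem_ofPred_eq] at hv hv'
      have e : w = w' := by simpa [h, h'] using hvv
      subst e
      exact Nat.succ_injective (((hM.pair _ hw _ hv.1).2 h).symm.trans ((hM.pair _ hw _ hv'.1).2 h'))
    have hdis : Disjoint C (C.image fun v => own v - 1) := by
      rw [disjoint_left]
      intro x hx hx'
      obtain ⟨v, hv, rfl⟩ := mem_image.1 hx'
      obtain ⟨w, hwI, hw, h⟩ := hown v hv
      simp [hC, h, hwI] at hx
    calc 2 * #C = #(C ∪ C.image fun v => own v - 1) := by
          rw [card_union_of_disjoint hdis, card_image_of_injOn hinj, two_mul]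
      _ ≤ matchedCount n mate := by
          refine card_le_card (union_subset ?_ ?_)
          · intro v hv
            simp only [hC, mem_filter, mem_range] at hv
            obtain ⟨⟨w, -, -, h⟩, -⟩ := h2 v hv.1 hv.2
            simp [hv.1, h]
          · intro x hx
            obtain ⟨v, hv, rfl⟩ := mem_image.1 hx
            obtain ⟨w, hwI, hw, h⟩ := hown v hv
            simp only [hC, mem_filter, mem_range] at hv
            have := (hM.pair _ hw _ hv.1).2 h
            simp [h, hw, this]

/-- The edges from `c` to `φ c` and from `φ c` to `c`, for `c ∈ C`, form a matching of the double
cover, so every cover has at least `2 * #C` vertices and so does the given matching. On the other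
hand, each matching edge has its left end in `C`, or its left end outside and its right end in `C`;
either kind occurs at most `#C` times. Equality in both bounds shows that both copies of every
vertex of `C` are matched, with partners outside `C`. -/
theorem splitsMatching_of_cover (hM : IsDoubleMatching n E mate own) (hmax : HasSmallCover n E mate)
    (hE : ∀ i j, E i j → E j i) {C : Finset ℕ} {φ : ℕ → ℕ}
    (hφ : Set.InjOn φ C) (hφC : ∀ c ∈ C, φ c ∉ C) (hφE : ∀ c ∈ C, E c (φ c))
    (hcover : ∀ i j, E i j → i ∈ C ∨ j ∈ C) :
    SplitsMatching n E mate own ∧ matchedCount n mate = 2 * #C := by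
  classical
  obtain ⟨W, W', hW, hcard⟩ := hmax
  -- On either side of the double cover, the ends `c` and `φ c` of the special edges are pairwise
  -- distinct, so a vertex of the cover meets at most one of these edges.
  have side : ∀ U : Finset ℕ, #{c ∈ C | c ∈ U} + #{c ∈ C | φ c ∈ U} ≤ #U := by
    intro U
    rw [← card_image_of_injOn (s := {c ∈ C | φ c ∈ U}) (f := φ)
      (hφ.mono fun c hc => (mem_filter.1 hc).1), ← card_union_of_disjoint]
    · refine card_le_card (union_subset (fun c hc => (mem_filter.1 hc).2) fun x hx => ?_)
      obtain ⟨c, hc, rfl⟩ := mem_image.1 hx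
      exact (mem_filter.1 hc).2
    · rw [disjoint_left]
      intro x hx hx'
      obtain ⟨c, hc, rfl⟩ := mem_image.1 hx'
      exact hφC c (mem_filter.1 hc).1 (mem_filter.1 hx).1
  have c1 : #C ≤ #{c ∈ C | c ∈ W} + #{c ∈ C | φ c ∈ W'} := by
    refine (card_le_card fun c hc => ?_).trans (card_union_le _ _)
    rcases hW _ _ (hφE c hc) with h | h <;> simp [hc, h]
  have c2 : #C ≤ #{c ∈ C | φ c ∈ W} + #{c ∈ C | c ∈ W'} := by
    refine (card_le_card fun c hc => ?_).trans (card_union_le _ _)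
    rcases hW _ _ (hE _ _ (hφE c hc)) with h | h <;> simp [hc, h]
  have s1 := side W
  have s2 := side W'
  set A₁ : Finset ℕ := {i ∈ range n | mate i ≠ 0 ∧ i ∈ C} with hA₁
  set A₂ : Finset ℕ := {i ∈ range n | mate i ≠ 0 ∧ i ∉ C} with hA₂
  set D : Finset ℕ := {j ∈ C | own j ≠ 0 ∧ own j - 1 ∉ C} with hD
  have hA : #A₁ + #A₂ = matchedCount n mate := by
    rw [matchedCount, ← card_filter_add_card_filter_not (s := {i ∈ range n | mate i ≠ 0}) (· ∈ C),
      filter_filter, filter_filter]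
  have hA₁C : A₁ ⊆ C := fun i hi => (mem_filter.1 hi).2.2
  have hA₂D : #A₂ ≤ #D := by
    refine card_le_card_of_injOn (fun i => mate i - 1) ?_ ?_
    · intro i hi
      simp only [hA₂, coe_filter, mem_range, Set.mem_ofPred_eq] at hi
      obtain ⟨j, hj, h⟩ := hM.exists_of_mate_ne_zero hi.1 hi.2.1
      have h' := (hM.pair _ hi.1 _ hj).1 h
      have := (hcover _ _ (hM.edge _ hi.1 _ hj h)).resolve_left hi.2.2
      simp [hD, h, this, h', hi.2.2]
    · intro i hi i' hi' he
      simp only [hA₂, coe_filter, mem_range, Set.mem_ofPred_eq] at hi hi'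
      obtain ⟨j, hj, h⟩ := hM.exists_of_mate_ne_zero hi.1 hi.2.1
      obtain ⟨j', hj', h'⟩ := hM.exists_of_mate_ne_zero hi'.1 hi'.2.1
      have e : j = j' := by simpa [h, h'] using he
      subst e
      exact Nat.succ_injective (((hM.pair _ hi.1 _ hj).1 h).symm.trans ((hM.pair _ hi'.1 _ hj).1 h'))
  have hDC : D ⊆ C := filter_subset _ _
  have k1 := card_le_card hA₁C
  have k2 := card_le_card hDC
  have e1 : A₁ = C := eq_of_subset_of_card_le hA₁C (by omega)
  have e2 : D = C := eq_of_subset_of_card_le hDC (by omega)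
  refine ⟨⟨{v | v ∉ C}, fun u v huv hu hv => (hcover u v huv).elim hu hv, fun v hv hvC => ?_⟩,
    by omega⟩
  simp only [Set.mem_ofPred_eq, not_not] at hvC ⊢
  have d1 := (mem_filter.1 (e1 ▸ hvC : v ∈ A₁)).2.1
  have d2 := (mem_filter.1 (e2 ▸ hvC : v ∈ D)).2
  obtain ⟨j, hj, h⟩ := hM.exists_of_mate_ne_zero hv d1
  obtain ⟨k, hk, h'⟩ := hM.exists_of_own_ne_zero hv d2.1
  refine ⟨⟨j, fun hjC => ?_, hj, h⟩, k, by simpa [h'] using d2.2, hk, h'⟩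
  -- If the partner `j` of `v` were in `C`, then by `D = C` its left partner, which is `v`, would
  -- lie outside `C`.
  have d3 := (mem_filter.1 (e2 ▸ hjC : j ∈ D)).2.2
  rw [(hM.pair _ hv _ hj).1 h] at d3
  exact d3 hvC

end IsDoubleMatching

/-! ### The auction algorithm -/

/-- The invariant of the auction: a matching, together with prices of the vertices on the right. -/
structure AuctionInvariant (n : ℕ) (E : ℕ → ℕ → Prop) (mate own price : ℕ → ℕ) : Prop
    extends IsDoubleMatching n E mate own where
  price_eq_zero : ∀ j < n, own j = 0 → price j = 0
  slack : ∀ i < n, ∀ j < n, ∀ j' < n, mate i = j + 1 → E i j' → price j ≤ price j' + 1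
  price_le : ∀ j < n, price j ≤ n + 2

/-- The vertex `i` on the left cannot bid: it is matched, or all prices are too high. -/
def CannotBid (n : ℕ) (E : ℕ → ℕ → Prop) (mate price : ℕ → ℕ) (i : ℕ) : Prop :=
  mate i ≠ 0 ∨ ∀ j < n, E i j → n + 2 ≤ price j

namespace AuctionInvariant

variable {n : ℕ} {E : ℕ → ℕ → Prop} {mate own price : ℕ → ℕ}

theorem init (n : ℕ) (E : ℕ → ℕ → Prop) {mate own price : ℕ → ℕ} (hm : ∀ i < n, mate i = 0)
    (ho : ∀ i < n, own i = 0) (hp : ∀ i < n, price i = 0) :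
    AuctionInvariant n E mate own price := by
  refine ⟨⟨?_, ?_, ?_, ?_⟩, ?_, ?_, ?_⟩ <;> grind

/-- The bidder takes a cheapest neighbor and raises its price by one, so its own slack is at most
one. For the other matched vertices slack survives because prices only grow, and the price of a
partner grows only when that partner is taken away. -/
theorem bid (h : AuctionInvariant n E mate own price) {i j : ℕ} (hi : i < n) (hj : j < n)
    (hmate : mate i = 0) (hij : E i j) (hmin : ∀ j' < n, E i j' → price j ≤ price j')
    (hprice : price j < n + 2) :
    AuctionInvariant n E
      (Function.update (if own j ≠ 0 then Function.update mate (own j - 1) 0 else mate) i (j + 1))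
      (Function.update own j (i + 1)) (Function.update price j (price j + 1)) := by
  obtain ⟨⟨h1, h2, h3, h4⟩, h5, h6, h7⟩ := h
  -- The new pairs are `(i, j)` and the old pairs that avoid both `i` and `j`; the previous owner of
  -- `j` becomes free.
  have hm : ∀ i' < n, ∀ j' < n, Function.update
      (if own j ≠ 0 then Function.update mate (own j - 1) 0 else mate) i (j + 1) i' = j' + 1 ↔
      (i' = i ∧ j' = j) ∨ (i' ≠ i ∧ j' ≠ j ∧ mate i' = j' + 1) := by
    intro i' hi' j' hj'
    by_cases hii : i' = i
    · subst hii; simp [eq_comm]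
    · have a1 := h1 i' hi' j hj
      have a2 := h1 i' hi' j' hj'
      by_cases ho : own j = 0
      · simp [hii, ho]
        grind
      · by_cases ho' : i' = own j - 1
        · have := h1 i' hi' j hj
          simp [ho, ho']
          grind
        · simp [hii, ho, ho']
          grind
  have hown : ∀ j' < n, ∀ i' < n, Function.update own j (i + 1) j' = i' + 1 ↔
      (i' = i ∧ j' = j) ∨ (i' ≠ i ∧ j' ≠ j ∧ own j' = i' + 1) := by
    intro j' hj' i' hi'
    by_cases hjj : j' = j
    · subst hjj; simp [eq_comm]
    · simp [hjj]
      grind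
  refine ⟨⟨?_, ?_, ?_, ?_⟩, ?_, ?_, ?_⟩
  · intro i' hi' j' hj'
    rw [hm i' hi' j' hj', hown j' hj' i' hi', h1 i' hi' j' hj']
  · intro i' hi'
    have := h2 i' hi'
    simp only [Function.update_apply]
    split_ifs <;> simp [Function.update_apply] <;> grind
  · intro j' hj'
    have := h3 j' hj'
    simp only [Function.update_apply]
    split_ifs <;> omega
  · intro i' hi' j' hj' he
    rcases (hm i' hi' j' hj').1 he with ⟨rfl, rfl⟩ | ⟨-, -, he⟩
    exacts [hij, h4 i' hi' j' hj' he]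
  · intro j' hj' he
    by_cases hjj : j' = j
    · subst hjj; simp at he
    · simp [hjj] at he ⊢
      exact h5 j' hj' he
  · intro i' hi' j' hj' j'' hj'' he hE
    rcases (hm i' hi' j' hj').1 he with ⟨rfl, rfl⟩ | ⟨-, hne, he⟩
    · have := hmin j'' hj'' hE
      simp only [Function.update_apply]
      split_ifs <;> omega
    · have := h6 i' hi' j' hj' j'' hj'' he hE
      simp only [Function.update_apply, if_neg hne]
      split_ifs with h
      · subst h; omega
      · omega
  · intro j' hj'
    have := h7 j' hj'
    simp only [Function.update_apply]
    split_ifs <;> omega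

/-- Choose a price level `k` that does not occur. The cover consists of the left vertices matched
below level `k` and the right vertices above it. If an edge ends at a right vertex below `k`, slack
places the partner of its left end at price at most `k`, hence below `k`; a left vertex that is
unmatched at the end has only neighbors of price at least `n + 2`. Right vertices above `k` have
positive price and so are matched, by edges other than those counted for the left part. -/
theorem hasSmallCover (h : AuctionInvariant n E mate own price) (hE : ∀ i j, E i j → i < n ∧ j < n)
    (hend : ∀ i < n, CannotBid n E mate price i) : HasSmallCover n E mate := by
  classical
  -- There are `n` prices for `n + 1` levels. The range keeps `k` below the ceiling `n + 2`.
  obtain ⟨k, hk, hgap⟩ : ∃ k ∈ Icc 1 (n + 1), k ∉ (range n).image price := by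
    apply exists_mem_notMem_of_card_lt_card
    refine (card_image_le).trans_lt ?_
    simp
  simp only [mem_Icc] at hk
  have hgap' : ∀ j < n, price j ≠ k := fun j hj he => hgap (mem_image.2 ⟨j, by simpa using hj, he⟩)
  set W : Finset ℕ := {i ∈ range n | ∃ j < n, mate i = j + 1 ∧ price j < k} with hW
  set W' : Finset ℕ := {j ∈ range n | k < price j} with hW'
  have hown : ∀ j ∈ W', j < n ∧ k < price j ∧ ∃ i < n, own j = i + 1 ∧ mate i = j + 1 := by
    intro j hj
    simp only [hW', mem_filter, mem_range] at hj
    have h0 : own j ≠ 0 := fun h0 => by have := h.price_eq_zero j hj.1 h0; omega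
    obtain ⟨i, hi, h'⟩ := h.exists_of_own_ne_zero hj.1 h0
    exact ⟨hj.1, hj.2, i, hi, h', (h.pair i hi j hj.1).2 h'⟩
  refine ⟨W, W', ?_, ?_⟩
  · intro i j hij
    obtain ⟨hi, hj⟩ := hE i j hij
    by_cases hkj : k < price j
    · exact .inr (by simp [hW', hj, hkj])
    · left
      rcases hend i hi with hm | hm
      · obtain ⟨j', hj', h'⟩ := h.exists_of_mate_ne_zero hi hm
        have := h.slack i hi j' hj' j hj h' hij
        have := hgap' j hj
        have := hgap' j' hj'
        simp only [hW, mem_filter, mem_range]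
        exact ⟨hi, j', hj', h', by omega⟩
      · have := hm j hj hij
        omega
  · have hinj : Set.InjOn (fun j => own j - 1) W' := by
      intro j hj j' hj' he
      obtain ⟨-, -, i, -, h1, h2⟩ := hown j hj
      obtain ⟨-, -, i', -, h1', h2'⟩ := hown j' hj'
      have e : i = i' := by simpa [h1, h1'] using he
      subst e
      omega
    rw [← card_image_of_injOn hinj, ← card_union_of_disjoint]
    · refine card_le_card (union_subset ?_ ?_)
      · intro i hi
        simp only [hW, mem_filter] at hi
        obtain ⟨hi, j, -, h', -⟩ := hi
        exact mem_filter.2 ⟨hi, by omega⟩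
      · intro x hx
        obtain ⟨j, hj, rfl⟩ := mem_image.1 hx
        obtain ⟨-, -, i, hi, h1, h2⟩ := hown j hj
        simp [h1, h2, hi]
    · rw [disjoint_left]
      intro x hx hx'
      obtain ⟨j, hj, rfl⟩ := mem_image.1 hx'
      obtain ⟨-, hp, i, hi, h1, h2⟩ := hown j hj
      simp only [hW, mem_filter, h1, Nat.add_sub_cancel] at hx
      obtain ⟨-, j', -, h3, h4⟩ := hx
      obtain rfl : j = j' := by omega
      omega

end AuctionInvariant

/-! ### The annihilation number -/

/-- The sum over a set of elements with the smallest values is the least possible. -/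
theorem sum_add_mul_card_le_of_threshold {V : Type*} {f : V → ℕ} {d : ℕ} {S : Finset V} (h₁ : ∀ v ∈ S, f v ≤ d)
    (h₂ : ∀ v ∉ S, d ≤ f v) (T : Finset V) : ∑ v ∈ S, f v + d * #T ≤ ∑ v ∈ T, f v + d * #S := by
  classical
  have e1 := sum_inter_add_sum_sdiff S T f
  have e2 := sum_inter_add_sum_sdiff T S f
  have c1 := card_sdiff_add_card_inter S T
  have c2 := card_sdiff_add_card_inter T S
  rw [inter_comm] at e2 c2
  have l1 : ∑ v ∈ S \ T, f v ≤ #(S \ T) * d :=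
    sum_le_card_nsmul _ _ _ fun v hv => h₁ v (mem_sdiff.1 hv).1
  have l2 : #(T \ S) * d ≤ ∑ v ∈ T \ S, f v :=
    card_nsmul_le_sum _ _ _ fun v hv => h₂ v (mem_sdiff.1 hv).2
  rw [← e1, ← e2, ← c1, ← c2]
  nlinarith

section AnnihilationNumber

variable {V : Type*} [Fintype V]

/-- Sorting the vertices instead of the values turns initial segments of the degree sequence into
sets of vertices. -/
theorem exists_list_pairwise_le (f : V → ℕ) :
    ∃ l : List V, l.Nodup ∧ (∀ v, v ∈ l) ∧ l.Pairwise (fun v w => f v ≤ f w) ∧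
      (l : Multiset V) = univ.val := by
  refine ⟨univ.toList.mergeSort (fun v w => decide (f v ≤ f w)), ?_, ?_, ?_, ?_⟩
  · exact (List.mergeSort_perm _ _).nodup_iff.2 (nodup_toList _)
  · intro v
    exact (List.mergeSort_perm _ _).mem_iff.2 (by simp)
  · refine (List.pairwise_mergeSort ?_ ?_ _).imp (by simp)
    · simpa using fun a b c => le_trans
    · simpa using fun a b => le_total _ _
  · rw [Multiset.coe_eq_coe.2 (List.mergeSort_perm _ _)]
    exact coe_toList _

open Classical in
/-- The initial segments of the degree sequence come from sets of vertices of smallest degree. -/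
theorem SimpleGraph.exists_sum_take_degreeSequence (G : SimpleGraph V) {k : ℕ}
    (hk : k ≤ Fintype.card V) :
    ∃ (S : Finset V) (d : ℕ), #S = k ∧ ∑ v ∈ S, G.degree v = (G.degreeSequence.take k).sum ∧
      (∀ v ∈ S, G.degree v ≤ d) ∧ ∀ v ∉ S, d ≤ G.degree v := by
  obtain ⟨l, hnd, hmem, hsort, hl⟩ := exists_list_pairwise_le fun v => G.degree v
  have hseq : G.degreeSequence = l.map fun v => G.degree v := by
    refine List.Perm.eq_of_pairwise (le := (· ≤ ·)) (fun a b _ _ => le_antisymm)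
      (Multiset.pairwise_sort _ _) (List.pairwise_map.2 hsort) ?_
    rw [← Multiset.coe_eq_coe, degreeSequence, Multiset.sort_eq, ← hl, Multiset.map_coe]
  have hlen : l.length = Fintype.card V := by
    rw [← Multiset.coe_card, hl]; rfl
  have hnd' : (l.take k).Nodup := hnd.sublist (List.take_sublist _ _)
  have hcross : ∀ v ∈ l.take k, ∀ w ∈ l.drop k, G.degree v ≤ G.degree w := by
    rw [← List.take_append_drop k l, List.pairwise_append] at hsort
    exact hsort.2.2
  refine ⟨(l.take k).toFinset, (l.take k).toFinset.sup fun v => G.degree v, ?_, ?_, ?_, ?_⟩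
  · rw [List.toFinset_card_of_nodup hnd', List.length_take, hlen, min_eq_left hk]
  · rw [List.sum_toFinset _ hnd', hseq, List.map_take]
  · exact fun v hv => le_sup (f := fun v => G.degree v) hv
  · intro w hw
    have hw' : w ∈ l.drop k := by
      have := hmem w
      rw [← List.take_append_drop k l, List.mem_append] at this
      exact this.resolve_left fun h => hw (List.mem_toFinset.2 h)
    exact Finset.sup_le fun v hv => hcross v (List.mem_toFinset.1 hv) w hw'

open Classical in
-- The first `#T` terms of the degree sequence have the least degree sum among all sets of that
-- size. Together with the next lemma this makes the annihilation number the maximum size of a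
-- vertex set with degree sum at most `m`, without reference to an ordering.
theorem SimpleGraph.card_le_annihilationNumber (G : SimpleGraph V) {T : Finset V}
    (hT : ∑ v ∈ T, G.degree v ≤ #G.edgeFinset) : #T ≤ G.annihilationNumber := by
  rcases Nat.eq_zero_or_pos (#T) with h0 | h0
  · omega
  obtain ⟨S, d, hS, hsum, h₁, h₂⟩ := G.exists_sum_take_degreeSequence (card_le_univ T)
  have := sum_add_mul_card_le_of_threshold h₁ h₂ T
  rw [hS] at this
  refine le_sup (f := id) (mem_filter.2 ⟨mem_Icc.2 ⟨h0, card_le_univ T⟩, ?_⟩)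
  change (G.degreeSequence.take #T).sum ≤ _
  rw [← hsum]
  omega

open Classical in
theorem SimpleGraph.exists_card_eq_annihilationNumber (G : SimpleGraph V) :
    ∃ T : Finset V, #T = G.annihilationNumber ∧ ∑ v ∈ T, G.degree v ≤ #G.edgeFinset := by
  by_cases h : ((Finset.Icc 1 (Fintype.card V)).filter fun a =>
    (G.degreeSequence.take a).sum ≤ G.edgeFinset.card).Nonempty
  · obtain ⟨a, ha, he⟩ := exists_mem_eq_sup _ h id
    rw [mem_filter, mem_Icc] at ha
    obtain ⟨S, d, hS, hsum, -⟩ := G.exists_sum_take_degreeSequence ha.1.2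
    refine ⟨S, hS.trans he.symm, ?_⟩
    rw [hsum]
    convert ha.2
  · refine ⟨∅, ?_, by simp⟩
    rw [annihilationNumber, not_nonempty_iff_eq_empty.1 h]
    simp

open Classical in
-- Certificate for the greedy algorithm: a larger set has degree sum at least that of `S` plus `d`,
-- which exceeds the number of edges.
theorem SimpleGraph.annihilationNumber_eq_card (G : SimpleGraph V) {S : Finset V} {d : ℕ}
    (h₁ : ∀ v ∈ S, G.degree v ≤ d) (h₂ : ∀ v ∉ S, d ≤ G.degree v)
    (hS : ∑ v ∈ S, G.degree v ≤ #G.edgeFinset)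
    (hmax : S = univ ∨ #G.edgeFinset < ∑ v ∈ S, G.degree v + d) :
    G.annihilationNumber = #S := by
  refine le_antisymm ?_ (G.card_le_annihilationNumber hS)
  obtain ⟨T, hT, hsum⟩ := G.exists_card_eq_annihilationNumber
  rw [← hT]
  rcases hmax with rfl | hmax
  · exact card_le_univ T
  · by_contra! hlt
    have := sum_add_mul_card_le_of_threshold h₁ h₂ T
    have := Nat.mul_le_mul_left d (Nat.succ_le_of_lt hlt)
    rw [Nat.mul_succ] at this
    omega

/-! ### Independent sets that attain the annihilation number. -/

open Classical in
/-- Twice the degree sum of a set, in terms of the edges inside the set and its complement. -/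
theorem SimpleGraph.two_mul_sum_degree (G : SimpleGraph V) (X : Finset V) :
    2 * ∑ v ∈ X, G.degree v + ∑ u ∈ Xᶜ, ∑ v ∈ Xᶜ, (if G.Adj u v then 1 else 0) =
      2 * #G.edgeFinset + ∑ u ∈ X, ∑ v ∈ X, (if G.Adj u v then 1 else 0) := by
  have hdeg : ∀ u, G.degree u =
      ∑ v ∈ X, (if G.Adj u v then 1 else 0) + ∑ v ∈ Xᶜ, (if G.Adj u v then 1 else 0) := by
    intro u
    rw [sum_add_sum_compl, sum_boole, ← card_neighborFinset_eq_degree, neighborFinset_eq_filter]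
    rfl
  have hsymm : ∑ u ∈ Xᶜ, ∑ v ∈ X, (if G.Adj u v then 1 else 0) =
      ∑ u ∈ X, ∑ v ∈ Xᶜ, (if G.Adj u v then 1 else 0) := by
    rw [sum_comm]
    simp only [G.adj_comm]
  have h := G.sum_degrees_eq_twice_card_edges
  rw [← sum_add_sum_compl X] at h
  simp only [hdeg, sum_add_distrib] at h ⊢
  rw [← h, hsymm]
  ring

/-- Every edge has at most one end in an independent set, so the degree sum of that set is at most
the number of edges. -/
theorem SimpleGraph.indepNum_le_annihilationNumber (G : SimpleGraph V) :
    G.indepNum ≤ G.annihilationNumber := by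
  classical
  obtain ⟨I, hI⟩ := G.exists_isNIndepSet_indepNum
  rw [← hI.card_eq]
  apply G.card_le_annihilationNumber
  have h := G.two_mul_sum_degree I
  have h0 : ∑ u ∈ I, ∑ v ∈ I, (if G.Adj u v then 1 else 0) = 0 :=
    sum_eq_zero fun u hu => sum_eq_zero fun v hv => if_neg fun huv =>
      hI.isIndepSet hu hv huv.ne huv
  omega

open Classical in
/-- If an independent set attains the annihilation number, then Hall's condition for matching its
complement into it is violated by at most one. -/
theorem SimpleGraph.card_le_card_neighbors_add_one (G : SimpleGraph V) {I S : Finset V}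
    (hI : G.IsIndepSet I) (hcard : #I = G.annihilationNumber) (hS : Disjoint S I) :
    #S ≤ #{v ∈ I | ∃ u ∈ S, G.Adj u v} + 1 := by
  by_contra! hlt
  set T : Finset V := {v ∈ I | ∃ u ∈ S, G.Adj u v} with hT
  have hTI : T ⊆ I := filter_subset _ _
  obtain ⟨s, hs⟩ : S.Nonempty := card_pos.1 (by omega)
  have hsI : s ∉ I := fun h => Finset.disjoint_left.1 hS hs h
  have big : ∀ U : Finset V, #I < #U → #G.edgeFinset < ∑ v ∈ U, G.degree v := by
    intro U hU
    by_contra! h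
    have := G.card_le_annihilationNumber h
    omega
  -- Exchange `T` for `S`. The sets `insert s I` and `A.erase s` both have more than `#I` elements,
  -- so their degree sums exceed `m`. In the sum of these two bounds the degree of `s` cancels, and
  -- the degree sums of `I` and `A` together are at least `2 * m + 2`.
  set A := (I \ T) ∪ S with hA
  have hdis : Disjoint (I \ T) S := (hS.mono_right sdiff_subset).symm
  have hcA : #A = #I - #T + #S := by
    rw [hA, card_union_of_disjoint hdis, card_sdiff_of_subset hTI]
  have hTle := card_le_card hTI
  have hsA : s ∈ A := mem_union_right _ hs
  have b1 := big (insert s I) (by rw [card_insert_of_notMem hsI]; omega)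
  have b2 := big (A.erase s) (by rw [card_erase_of_mem hsA]; omega)
  rw [sum_insert hsI] at b1
  have b3 := sum_erase_add A (fun v => G.degree v) hsA
  have e1 := G.two_mul_sum_degree I
  have e2 := G.two_mul_sum_degree A
  have h0 : ∑ u ∈ I, ∑ v ∈ I, (if G.Adj u v then 1 else 0) = 0 :=
    sum_eq_zero fun u hu => sum_eq_zero fun v hv => if_neg fun huv => hI hu hv huv.ne huv
  -- All edges inside `A` lie inside `S`, hence outside `I`. Therefore the surplus of edges inside
  -- `A` is compensated by the deficit of `I`, and the two degree sums add up to at most `2 * m`.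
  have h1 : ∑ u ∈ A, ∑ v ∈ A, (if G.Adj u v then 1 else 0) ≤
      ∑ u ∈ Iᶜ, ∑ v ∈ Iᶜ, (if G.Adj u v then 1 else 0) := by
    rw [← sum_product', ← sum_product', ← card_filter, ← card_filter]
    refine card_le_card ?_
    rintro ⟨u, v⟩ huv
    simp only [mem_filter, mem_product, mem_compl] at huv ⊢
    obtain ⟨⟨hu, hv⟩, huv⟩ := huv
    have key : ∀ u v, u ∈ A → v ∈ A → G.Adj u v → u ∈ S := by
      intro u v hu hv huv
      by_contra huS
      have hu' : u ∈ I \ T := (mem_union.1 hu).resolve_right huS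
      rw [mem_sdiff] at hu'
      by_cases hvS : v ∈ S
      · exact hu'.2 (mem_filter.2 ⟨hu'.1, v, hvS, huv.symm⟩)
      · have hv' : v ∈ I \ T := (mem_union.1 hv).resolve_right hvS
        exact hI hu'.1 (mem_sdiff.1 hv').1 huv.ne huv
    exact ⟨⟨Finset.disjoint_left.1 hS (key u v hu hv huv), Finset.disjoint_left.1 hS (key v u hv hu huv.symm)⟩, huv⟩
  omega

/-- If an independent set attains the annihilation number, then its complement can be matched into
it, up to one vertex. -/
theorem SimpleGraph.exists_injOn_of_card_eq_annihilationNumber (G : SimpleGraph V) {I : Finset V}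
    (hI : G.IsIndepSet I) (hcard : #I = G.annihilationNumber) (hV : ∃ c, c ∉ I) :
    ∃ c ∉ I, ∃ φ : V → V, Set.InjOn φ {v | v ∉ I ∧ v ≠ c} ∧
      ∀ v, v ∉ I → v ≠ c → φ v ∈ I ∧ G.Adj v (φ v) := by
  classical
  -- The extra element `none` is a dummy neighbor of every vertex outside `I`; it absorbs the
  -- deficiency of one in Hall's condition. The vertex matched with it becomes `c`, and if there is
  -- none, any vertex outside `I` serves.
  let t : {v // v ∉ I} → Finset (Option V) := fun v => insertNone {w ∈ I | G.Adj v w}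
  obtain ⟨f, hf, hft⟩ := (all_card_le_biUnion_card_iff_exists_injective t).1 fun S => by
    rcases S.eq_empty_or_nonempty with rfl | ⟨x, hx⟩
    · simp
    have h := G.card_le_card_neighbors_add_one (S := S.map (Function.Embedding.subtype _)) hI hcard
      (Finset.disjoint_left.2 fun v hv => by
        obtain ⟨w, -, rfl⟩ := mem_map.1 hv
        exact w.2)
    rw [card_map] at h
    refine h.trans ?_
    rw [← card_insertNone]
    refine card_le_card fun o ho => ?_
    cases o with
    | none => exact mem_biUnion.2 ⟨x, hx, by simp [t]⟩
    | some w =>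
      simp only [some_mem_insertNone, mem_filter, mem_map, Function.Embedding.subtype_apply] at ho
      obtain ⟨hw, _, ⟨u, hu, rfl⟩, huw⟩ := ho
      exact mem_biUnion.2 ⟨u, hu, by simp [t, hw, huw]⟩
  obtain ⟨c, hc, hcn⟩ : ∃ c, c ∉ I ∧ ∀ v : {v // v ∉ I}, v.1 ≠ c → f v ≠ none := by
    by_cases h : ∃ v, f v = none
    · obtain ⟨c, hc⟩ := h
      exact ⟨c.1, c.2, fun v hv hn => hv (congrArg Subtype.val (hf (hn.trans hc.symm)))⟩
    · obtain ⟨c, hc⟩ := hV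
      exact ⟨c, hc, fun v _ hn => h ⟨v, hn⟩⟩
  have hφ : ∀ v : {v // v ∉ I}, v.1 ≠ c → ∃ w, f v = some w :=
    fun v hv => Option.ne_none_iff_exists'.1 (hcn v hv)
  refine ⟨c, hc, fun v => if h : v ∉ I then (f ⟨v, h⟩).getD v else v, ?_, ?_⟩
  · rintro v ⟨hv, hvc⟩ v' ⟨hv', hvc'⟩ he
    obtain ⟨w, hw⟩ := hφ ⟨v, hv⟩ hvc
    obtain ⟨w', hw'⟩ := hφ ⟨v', hv'⟩ hvc'
    simp only [hv, hv', not_false_eq_true, dite_true, hw, hw', Option.getD_some] at he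
    subst he
    exact congrArg Subtype.val (hf (hw.trans hw'.symm))
  · intro v hv hvc
    obtain ⟨w, hw⟩ := hφ ⟨v, hv⟩ hvc
    have := hft ⟨v, hv⟩
    simpa [t, hw, hv] using this

end AnnihilationNumber

namespace RAM

/-! ### Graphs on an initial segment of the natural numbers -/

section Segment

variable {n : ℕ} (G : SimpleGraph (Fin n))

/-- Adjacency in the graph in which all edges at the vertex `c` are deleted. -/
def AdjAvoiding (c i j : ℕ) : Prop := i ≠ c ∧ j ≠ c ∧ adjEntry G i j ≠ 0

variable {G}

theorem adjEntry_ne_zero_iff {i j : ℕ} :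
    adjEntry G i j ≠ 0 ↔ ∃ (hi : i < n) (hj : j < n), G.Adj ⟨i, hi⟩ ⟨j, hj⟩ := by
  simp [adjEntry]

theorem AdjAvoiding.symm {c i j : ℕ} (h : AdjAvoiding G c i j) : AdjAvoiding G c j i := by
  refine ⟨h.2.1, h.1, ?_⟩
  obtain ⟨hi, hj, h⟩ := adjEntry_ne_zero_iff.1 h.2.2
  exact adjEntry_ne_zero_iff.2 ⟨hj, hi, h.symm⟩

theorem AdjAvoiding.lt {c i j : ℕ} (h : AdjAvoiding G c i j) : i < n ∧ j < n := by
  obtain ⟨hi, hj, h⟩ := adjEntry_ne_zero_iff.1 h.2.2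
  exact ⟨hi, hj⟩

open Classical in
theorem sum_adjEntry (i : Fin n) : ∑ j ∈ range n, adjEntry G i j = G.degree i := by
  rw [← Fin.sum_univ_eq_sum_range (fun j => adjEntry G i j), ← SimpleGraph.card_neighborFinset_eq_degree,
    SimpleGraph.neighborFinset_eq_filter, card_filter]
  simp [adjEntry]

open Classical in
theorem sum_sum_adjEntry :
    ∑ i ∈ range n, ∑ j ∈ range n, adjEntry G i j = 2 * #G.edgeFinset := by
  rw [← G.sum_degrees_eq_twice_card_edges, ← Fin.sum_univ_eq_sum_range
    (fun i => ∑ j ∈ range n, adjEntry G i j)]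
  exact sum_congr rfl fun i _ => sum_adjEntry i

/-- The correctness of the algorithm, up to the computation of maximum matchings and the solution of
instances of two-satisfiability. -/
theorem indepNum_eq_annihilationNumber_iff {mate own : ℕ → ℕ → ℕ}
    (hM : ∀ c < n, IsDoubleMatching n (AdjAvoiding G c) (mate c) (own c))
    (hmax : ∀ c < n, HasSmallCover n (AdjAvoiding G c) (mate c)) :
    G.indepNum = G.annihilationNumber ↔ n = G.annihilationNumber ∨
      ∃ c < n, SplitsMatching n (AdjAvoiding G c) (mate c) (own c) ∧
        matchedCount n (mate c) + 2 * G.annihilationNumber + 2 ≤ 2 * n := by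
  classical
  constructor
  · intro h
    obtain ⟨I, hI⟩ := G.exists_isNIndepSet_indepNum
    have hcard := hI.card_eq.trans h
    -- If `I` is everything, there is no vertex `c` to choose; this is the alternative in which `n`
    -- is the annihilation number.
    by_cases hV : ∃ c, c ∉ I
    · right
      obtain ⟨c, hc, φ, hφ, hφI⟩ := G.exists_injOn_of_card_eq_annihilationNumber hI.isIndepSet hcard hV
      set C : Finset ℕ := (Iᶜ.erase c).map Fin.valEmbedding with hC
      have hmemC : ∀ i, i ∈ C ↔ ∃ h : i < n, ⟨i, h⟩ ∉ I ∧ ⟨i, h⟩ ≠ c := by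
        intro i
        simp only [hC, mem_map, mem_erase, mem_compl, Fin.valEmbedding_apply]
        constructor
        · rintro ⟨a, ⟨h1, h2⟩, rfl⟩
          exact ⟨a.2, h2, h1⟩
        · rintro ⟨h, h1, h2⟩
          exact ⟨⟨i, h⟩, ⟨h2, h1⟩, rfl⟩
      have key := (hM c c.2).splitsMatching_of_cover (hmax c c.2) (fun i j h => h.symm) (C := C)
        (φ := fun i => if h : i < n then (φ ⟨i, h⟩).1 else i) ?_ ?_ ?_ ?_
      · refine ⟨c, c.2, key.1, ?_⟩
        have hcC : #C + 1 = n - G.annihilationNumber := by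
          rw [hC, card_map, card_erase_add_one (mem_compl.2 hc), card_compl, Fintype.card_fin, hcard]
        have := key.2
        omega
      · intro i hi j hj he
        obtain ⟨hi, hi'⟩ := (hmemC i).1 hi
        obtain ⟨hj, hj'⟩ := (hmemC j).1 hj
        simp only [hi, hj, dite_true] at he
        exact congrArg Fin.val (hφ hi' hj' (Fin.ext he))
      · intro i hi hi'
        obtain ⟨hi, h1, h2⟩ := (hmemC i).1 hi
        simp only [hi, dite_true] at hi'
        rw [hmemC] at hi'
        exact hi'.2.1 (hφI _ h1 h2).1
      · intro i hi
        obtain ⟨hi, h1, h2⟩ := (hmemC i).1 hi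
        obtain ⟨h3, h4⟩ := hφI _ h1 h2
        simp only [hi, dite_true]
        refine ⟨fun h => h2 (Fin.ext h), fun h => hc (Fin.ext h ▸ h3), ?_⟩
        exact adjEntry_ne_zero_iff.2 ⟨hi, (φ ⟨i, hi⟩).2, h4⟩
      · intro i j hij
        obtain ⟨hi, hj, h⟩ := adjEntry_ne_zero_iff.1 hij.2.2
        by_contra! hn
        rw [hmemC, hmemC] at hn
        have h1 : ⟨i, hi⟩ ∈ I := by
          by_contra hiI
          exact hn.1 ⟨hi, hiI, fun h => hij.1 (congrArg Fin.val h)⟩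
        have h2 : ⟨j, hj⟩ ∈ I := by
          by_contra hjI
          exact hn.2 ⟨hj, hjI, fun h => hij.2.1 (congrArg Fin.val h)⟩
        exact hI.isIndepSet h1 h2 h.ne h
    · left
      push Not at hV
      rw [← hcard, eq_univ_of_forall hV, card_univ, Fintype.card_fin]
  · intro h
    refine le_antisymm G.indepNum_le_annihilationNumber ?_
    rcases h with h | ⟨c, hc, hs, hcount⟩
    · obtain ⟨T, hT, hsum⟩ := G.exists_card_eq_annihilationNumber
      have hTu : T = univ := by
        rw [← card_eq_iff_eq_univ, hT, ← h, Fintype.card_fin]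
      have h0 : #G.edgeFinset = 0 := by
        have := G.sum_degrees_eq_twice_card_edges
        rw [hTu] at hsum
        omega
      rw [card_eq_zero, SimpleGraph.edgeFinset_eq_empty] at h0
      rw [← hT]
      apply SimpleGraph.IsIndepSet.card_le_indepNum
      intro u _ v _ _
      simp [h0]
    · obtain ⟨C, hCn, hC, hCcard⟩ := (hM c hc).exists_independent_of_splitsMatching hs
      set J : Finset (Fin n) := {v | v.1 ∉ C ∧ v.1 ≠ c} with hJ
      have hJi : G.IsIndepSet J := by
        intro u hu v hv _ huv
        simp only [hJ, coe_filter, mem_univ, true_and, Set.mem_ofPred_eq] at hu hv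
        exact (hC u u.2 v v.2 ⟨hu.2, hv.2, adjEntry_ne_zero_iff.2 ⟨u.2, v.2, huv⟩⟩).elim hu.1 hv.1
      refine le_trans ?_ hJi.card_le_indepNum
      have hJm : J.map Fin.valEmbedding = (range n \ C).erase c := by
        ext i
        simp only [hJ, mem_map, mem_filter, mem_univ, true_and, Fin.valEmbedding_apply, mem_erase,
          mem_sdiff, mem_range]
        constructor
        · rintro ⟨a, h, rfl⟩
          exact ⟨h.2, a.2, h.1⟩
        · rintro ⟨h1, h2, h3⟩
          exact ⟨⟨i, h2⟩, ⟨h3, h1⟩, rfl⟩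
      -- Removing `c` costs at most one vertex, and `2 * #C` is at most the size of the matching;
      -- this is where the summand 2 in the inequality comes from.
      have h1 := pred_card_le_card_erase (s := range n \ C) (a := c)
      rw [← hJm, card_map, card_sdiff_of_subset hCn, card_range] at h1
      omega

end Segment

/-! ### Derived expressions -/

/-- Equality, as a number. -/
def Expr.eq (a b : Expr) : Expr :=
  .ite (.sub a b) (.const 0) (.ite (.sub b a) (.const 0) (.const 1))

/-- Comparison, as a number. -/
def Expr.le (a b : Expr) : Expr := .ite (.sub a b) (.const 0) (.const 1)

/-- Adjacency in the graph in which all edges at the vertex stored in the variable `c` are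
deleted. -/
def Expr.adjAvoiding (a b : Expr) : Expr :=
  .ite (.eq a (.var .c)) (.const 0) (.ite (.eq b (.var .c)) (.const 0) (.adj a b))

section ExprEval

variable {n : ℕ} (G : SimpleGraph (Fin n)) (s : Store)

theorem Expr.eval_eq (a b : Expr) :
    (Expr.eq a b).eval G s = if a.eval G s = b.eval G s then 1 else 0 := by
  simp only [Expr.eq, Expr.eval]
  rcases lt_trichotomy (a.eval G s) (b.eval G s) with h | h | h
  · simp [h.ne, h.le, Nat.sub_ne_zero_of_lt h]
  · simp [h]
  · simp [h.ne', Nat.sub_ne_zero_of_lt h]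

theorem Expr.eval_le (a b : Expr) :
    (Expr.le a b).eval G s = if a.eval G s ≤ b.eval G s then 1 else 0 := by
  simp only [Expr.le, Expr.eval]
  rcases le_or_gt (a.eval G s) (b.eval G s) with h | h
  · simp [h]
  · simp [h.not_ge, Nat.sub_ne_zero_of_lt h]

theorem Expr.eval_adjAvoiding_ne_zero_iff (a b : Expr) :
    (Expr.adjAvoiding a b).eval G s ≠ 0 ↔ AdjAvoiding G (s.v .c) (a.eval G s) (b.eval G s) := by
  simp only [Expr.adjAvoiding, Expr.eval, Expr.eval_eq, AdjAvoiding]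
  by_cases h1 : a.eval G s = s.v .c
  · simp [h1]
  · by_cases h2 : b.eval G s = s.v .c <;> simp [h1, h2]

end ExprEval

/-! ### The programs -/

/-- Compute the degree of the vertex `i`. -/
def degreeCmd : Cmd :=
  .seq (.set .deg (.const 0))
    (.loop .j 0 (.set .deg (.add (.var .deg) (.adj (.var .i) (.var .j)))))

/-- Compute the degree sum of the graph. -/
def totalCmd : Cmd :=
  .seq (.set .total (.const 0))
    (.loop .i 0 (.seq degreeCmd (.set .total (.add (.var .total) (.var .deg)))))

/-- Take the vertex `i` if it has degree `n - 1 - k` and does not make the degree sum too large. -/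
def greedyStepCmd : Cmd :=
  .seq degreeCmd <|
  .cond (.ite (.eq (.var .deg) (.sub (.sub .order (.const 1)) (.var .k)))
      (.le (.add (.add (.var .sum) (.var .deg)) (.add (.var .sum) (.var .deg))) (.var .total))
      (.const 0))
    (.seq (.set .sum (.add (.var .sum) (.var .deg))) (.set .ann (.add (.var .ann) (.const 1))))
    .skip

/-- Compute the annihilation number. -/
def annihilationCmd : Cmd :=
  .seq totalCmd <| .seq (.set .sum (.const 0)) <| .seq (.set .ann (.const 0)) <|
  .loop .k 0 (.loop .i 0 greedyStepCmd)

/-- Start the auction. -/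
def initCmd : Cmd :=
  .loop .i 0 <| .seq (.put .own (.var .i) (.const 0)) <| .seq (.put .mate (.var .i) (.const 0))
    (.put .price (.var .i) (.const 0))

/-- Find a neighbor of `i` of lowest price. -/
def cheapestCmd : Cmd :=
  .seq (.set .best (.add .order (.const 2))) <|
  .loop .j 0 <| .cond (.adjAvoiding (.var .i) (.var .j))
    (.cond (.sub (.var .best) (.get .price (.var .j)))
      (.seq (.set .best (.get .price (.var .j))) (.set .arg (.var .j))) .skip) .skip

/-- Match `i` with the vertex `arg`. -/
def assignCmd : Cmd :=
  .seq (.cond (.get .own (.var .arg))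
    (.put .mate (.sub (.get .own (.var .arg)) (.const 1)) (.const 0)) .skip) <|
  .seq (.put .own (.var .arg) (.add (.var .i) (.const 1))) <|
  .seq (.put .mate (.var .i) (.add (.var .arg) (.const 1)))
    (.put .price (.var .arg) (.add (.var .best) (.const 1)))

/-- The bid of the vertex `i`. -/
def bidCmd : Cmd :=
  .cond (.get .mate (.var .i)) .skip <| .seq cheapestCmd <|
    .cond (.sub (.add .order (.const 2)) (.var .best)) assignCmd .skip

/-- Run a command `(n + 2) ^ 2` times. -/
def repeatCmd (p : Cmd) : Cmd := .loop .r 2 (.loop .r' 2 p)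

/-- Count the edges of the matching. -/
def countCmd : Cmd :=
  .seq (.set .cnt (.const 0)) <|
  .loop .i 0 (.cond (.get .mate (.var .i)) (.set .cnt (.add (.var .cnt) (.const 1))) .skip)

/-- Mark the partner of `i`, or `i` itself if it has none. -/
def markPartnerCmd (k : Arr) : Cmd :=
  .cond (.get k (.var .i)) (.put .pos (.sub (.get k (.var .i)) (.const 1)) (.const 1))
    (.put .pos (.var .i) (.const 1))

/-- Mark the consequences of the literal that `i` is not in the independent set. -/
def negStepCmd : Cmd :=
  .cond (.get .neg (.var .i)) (.seq (markPartnerCmd .mate) (markPartnerCmd .own)) .skip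

/-- Mark the consequences of the literal that `i` is in the independent set. -/
def posStepCmd : Cmd :=
  .cond (.get .pos (.var .i))
    (.loop .j 0 (.cond (.adjAvoiding (.var .i) (.var .j)) (.put .neg (.var .j) (.const 1)) .skip))
    .skip

/-- Mark all literals that follow from marked ones. -/
def closureCmd : Cmd := repeatCmd (.loop .i 0 (.seq negStepCmd posStepCmd))

/-- Remove all marks. -/
def clearCmd : Cmd :=
  .loop .i 0 (.seq (.put .pos (.var .i) (.const 0)) (.put .neg (.var .i) (.const 0)))

/-- The array of the marks of positive or negative literals. -/
def markArr : Bool → Arr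
  | true => .pos
  | false => .neg

/-- Mark all literals that follow from a literal for the vertex `u`. -/
def reachCmd (b : Bool) : Cmd :=
  .seq clearCmd <| .seq (.put (markArr b) (.var .u) (.const 1)) closureCmd

/-- Decide whether the matching splits. -/
def splitsCmd : Cmd :=
  .seq (.set .ok (.const 1)) <| .loop .u 0 <|
  .seq (reachCmd true) <| .seq (.set .f (.get .neg (.var .u))) <| .seq (reachCmd false) <|
  .cond (.ite (.var .f) (.get .pos (.var .u)) (.const 0)) (.set .ok (.const 0)) .skip

/-- The test for a fixed vertex `c`. -/
def testCmd : Cmd :=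
  .seq initCmd <| .seq (repeatCmd (.loop .i 0 bidCmd)) <| .seq countCmd <| .seq splitsCmd <|
  .cond (.ite (.var .ok)
      (.le (.add (.add (.var .cnt) (.add (.var .ann) (.var .ann))) (.const 2)) (.add .order .order))
      (.const 0))
    (.set .res (.const 1)) .skip

/-- Decide whether the independence number equals the annihilation number. -/
def decideCmd : Cmd :=
  .seq annihilationCmd <| .seq (.set .res (.eq .order (.var .ann))) <| .loop .c 0 testCmd

theorem decideCmd_WF : decideCmd.WF := by
  simp [decideCmd, testCmd, splitsCmd, reachCmd, clearCmd, closureCmd, posStepCmd, negStepCmd,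
    markPartnerCmd, countCmd,
    repeatCmd, bidCmd, assignCmd, cheapestCmd, initCmd, annihilationCmd, greedyStepCmd, totalCmd,
    degreeCmd, Cmd.WF, Cmd.Writes]

section Correctness

variable {n : ℕ} {G : SimpleGraph (Fin n)}

/-! ### Computing the annihilation number -/

theorem eval_degreeCmd (s : Store) :
    (degreeCmd.eval G s).v .deg = ∑ j ∈ range n, adjEntry G (s.v .i) j := by
  have := Cmd.eval_loop_induction_frame G (x := .j) (c := 0)
    (p := .set .deg (.add (.var .deg) (.adj (.var .i) (.var .j))))
    (s := s.setV .deg 0)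
    (fun k s' => s'.v .deg = ∑ j ∈ Ico k n, adjEntry G (s.v .i) j) (by simp) ?_
  · rw [← Nat.Ico_zero_eq_range]
    exact this
  · intro k hk s' hv _ hI
    have hi := hv .i (by simp [Cmd.Writes])
    simp only [Store.setV_v, ne_eq, reduceCtorEq, not_false_eq_true, Function.update_of_ne] at hi
    rw [sum_eq_sum_Ico_succ_bot (by omega)]
    simp [Cmd.eval, Expr.eval, hI, hi]
    ring

open Classical in
theorem eval_totalCmd (s : Store) : (totalCmd.eval G s).v .total = 2 * #G.edgeFinset := by
  have := Cmd.eval_loop_induction_frame G (x := .i) (c := 0)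
    (p := .seq degreeCmd (.set .total (.add (.var .total) (.var .deg))))
    (s := s.setV .total 0)
    (fun k s' => s'.v .total = ∑ i ∈ Ico k n, ∑ j ∈ range n, adjEntry G i j) (by simp) ?_
  · rw [← sum_sum_adjEntry]
    simp only [Nat.Ico_zero_eq_range] at this
    exact this
  · intro k hk s' hv _ hI
    rw [sum_eq_sum_Ico_succ_bot (by omega)]
    simp only [Cmd.eval, Expr.eval, Store.setV_v, Function.update_self, eval_degreeCmd]
    rw [Cmd.eval_v_of_not_writes G (by simp [degreeCmd, Cmd.Writes])]
    simp [hI]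
    ring

open Classical in
/-- The greedy algorithm has chosen the set of all vertices with the property `P`, unless it is not
possible to choose any more vertices. -/
def GreedyInvariant (G : SimpleGraph (Fin n)) (P : Fin n → Prop) (s : Store) : Prop :=
  ∃ S : Finset (Fin n), #S = s.v .ann ∧ ∑ v ∈ S, G.degree v = s.v .sum ∧
    2 * s.v .sum ≤ 2 * #G.edgeFinset ∧ s.v .total = 2 * #G.edgeFinset ∧ (∀ v ∈ S, P v) ∧
    ((∀ v, P v → v ∈ S) ∨ ∃ d, #G.edgeFinset < s.v .sum + d ∧ (∀ v ∈ S, G.degree v ≤ d) ∧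
      ∀ v ∉ S, d ≤ G.degree v)

open Classical in
-- The first vertex of the current degree that no longer fits supplies the threshold `d`. From then
-- on every unchosen vertex has degree at least `d`, so nothing fits any more and the chosen set
-- stays fixed.
theorem GreedyInvariant.step {k m : ℕ} (hm : m < n) {s : Store} (hsk : s.v .k = k)
    (hsi : s.v .i = m)
    (h : GreedyInvariant G (fun v => G.degree v < n - 1 - k ∨ G.degree v = n - 1 - k ∧ m + 1 ≤ v) s) :
    GreedyInvariant G (fun v => G.degree v < n - 1 - k ∨ G.degree v = n - 1 - k ∧ m ≤ v)
      (greedyStepCmd.eval G s) := by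
  obtain ⟨S, h1, h2, h3, h4, h5, h6⟩ := h
  set s' := degreeCmd.eval G s with hs'
  have hd : s'.v .deg = G.degree ⟨m, hm⟩ := by
    rw [hs', eval_degreeCmd, hsi, ← sum_adjEntry]
  have hf : ∀ y, ¬ degreeCmd.Writes y → s'.v y = s.v y := fun y hy =>
    Cmd.eval_v_of_not_writes G hy s
  have f1 := hf .k (by simp [degreeCmd, Cmd.Writes])
  have f2 := hf .sum (by simp [degreeCmd, Cmd.Writes])
  have f3 := hf .ann (by simp [degreeCmd, Cmd.Writes])
  have f4 := hf .total (by simp [degreeCmd, Cmd.Writes])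
  have key : greedyStepCmd.eval G s =
      if G.degree ⟨m, hm⟩ = n - 1 - k ∧ s.v .sum + G.degree ⟨m, hm⟩ ≤ #G.edgeFinset then
        (s'.setV .sum (s.v .sum + G.degree ⟨m, hm⟩)).setV .ann (s.v .ann + 1) else s' := by
    simp only [greedyStepCmd, Cmd.eval, ← hs', Expr.eval, Expr.eval_eq, Expr.eval_le, hd, f1, f2, f4,
      hsk, h4]
    by_cases e1 : G.degree ⟨m, hm⟩ = n - 1 - k
    · by_cases e2 : s.v .sum + G.degree ⟨m, hm⟩ ≤ #G.edgeFinset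
      -- The program has only the degree sum `2 * m` at hand and no division, so it compares doubled
      -- quantities.
      · have e3 : s.v .sum + G.degree ⟨m, hm⟩ + (s.v .sum + G.degree ⟨m, hm⟩) ≤ 2 * #G.edgeFinset := by
          omega
        rw [if_pos (by simp [e1] at e3 ⊢; exact e3), if_pos ⟨e1, e2⟩]
        simp [f3]
      · have e3 : ¬ s.v .sum + G.degree ⟨m, hm⟩ + (s.v .sum + G.degree ⟨m, hm⟩) ≤ 2 * #G.edgeFinset := by
          omega
        rw [if_neg (by simp [e1] at e3 ⊢; exact e3), if_neg fun h => e2 h.2]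
    · rw [if_neg (by simp [e1]), if_neg fun h => e1 h.1]
  have hlast : ∀ v : Fin n, m ≤ v.1 → v = ⟨m, hm⟩ ∨ m + 1 ≤ v.1 := fun v hv => by
    rcases hv.eq_or_lt with h | h
    · exact .inl (Fin.ext h.symm)
    · exact .inr h
  rw [key]
  split_ifs with hc
  · obtain ⟨hc1, hc2⟩ := hc
    have hmS : ⟨m, hm⟩ ∉ S := fun hS => by
      rcases h5 _ hS with h | h
      · omega
      · simp at h
    refine ⟨insert ⟨m, hm⟩ S, ?_, ?_, ?_, ?_, ?_, .inl fun v hv => ?_⟩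
    · simp [card_insert_of_notMem hmS, h1]
    · simp [sum_insert hmS, h2, add_comm]
    · simpa using hc2
    · simp [f4, h4]
    · intro v hv
      rcases mem_insert.1 hv with rfl | hv
      · exact .inr ⟨hc1, le_rfl⟩
      · rcases h5 v hv with h | h
        · exact .inl h
        · exact .inr ⟨h.1, by omega⟩
    · rw [mem_insert]
      rcases h6 with h6 | ⟨d, hd1, hd2, hd3⟩
      · rcases hv with hv | ⟨hv1, hv2⟩
        · exact .inr (h6 v (.inl hv))
        · exact (hlast v hv2).imp_right fun h => h6 v (.inr ⟨hv1, h⟩)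
      · have := hd3 _ hmS
        omega
  · refine ⟨S, by rw [f3, h1], by rw [f2, h2], by rwa [f2], by rw [f4, h4], fun v hv => ?_, ?_⟩
    · rcases h5 v hv with h | h
      · exact .inl h
      · exact .inr ⟨h.1, by omega⟩
    · rw [f2]
      rcases h6 with h6 | h6
      · by_cases e1 : G.degree ⟨m, hm⟩ = n - 1 - k
        · right
          refine ⟨n - 1 - k, ?_, fun v hv => ?_, fun v hv => ?_⟩
          · by_contra! hle
            exact hc ⟨e1, by omega⟩
          · rcases h5 v hv with h | h <;> omega
          · by_contra! hlt
            exact hv (h6 v (.inl hlt))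
        · left
          rintro v (hv | ⟨hv1, hv2⟩)
          · exact h6 v (.inl hv)
          · rcases hlast v hv2 with rfl | h
            · exact absurd hv1 e1
            · exact h6 v (.inr ⟨hv1, h⟩)
      · exact .inr h6

/-- Loop counters run downwards, so the vertices are processed by increasing degree `n - 1 - k`. At
the end all vertices are chosen or a threshold exists, and either one certifies optimality. -/
theorem eval_annihilationCmd (s : Store) :
    (annihilationCmd.eval G s).v .ann = G.annihilationNumber := by
  classical
  set s₀ := ((totalCmd.eval G s).setV .sum 0).setV .ann 0 with hs₀
  have hmono : ∀ {P Q : Fin n → Prop} {s : Store}, (∀ v, P v ↔ Q v) → GreedyInvariant G P s →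
      GreedyInvariant G Q s := by
    intro P Q s h hP
    obtain rfl : P = Q := funext fun v => propext (h v)
    exact hP
  have hstart : GreedyInvariant G (fun v => G.degree v < n - n) s₀ := by
    refine ⟨∅, ?_, ?_, ?_, ?_, ?_, ?_⟩ <;> simp [hs₀, eval_totalCmd]
  have hset : ∀ {P : Fin n → Prop} {s : Store} (x : Var) (z : ℕ), x ≠ .sum → x ≠ .ann →
      x ≠ .total → GreedyInvariant G P s → GreedyInvariant G P (s.setV x z) := by
    intro P s x z h1 h2 h3 h
    simpa [GreedyInvariant, h1.symm, h2.symm, h3.symm] using h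
  have houter := Cmd.eval_loop_induction_frame G (x := .k) (c := 0) (p := .loop .i 0 greedyStepCmd)
    (s := s₀) (fun k s' => GreedyInvariant G (fun v => G.degree v < n - k) s')
    (hset _ _ (by simp) (by simp) (by simp) hstart) (by
      intro k hk s' _ _ hI
      have hk : k < n := hk
      have hinner := Cmd.eval_loop_induction_frame G (x := .i) (c := 0) (p := greedyStepCmd)
        (s := s'.setV .k k) (fun m s'' =>
          GreedyInvariant G (fun v => G.degree v < n - 1 - k ∨ G.degree v = n - 1 - k ∧ m ≤ v) s'')
        (by
          refine hset _ _ (by simp) (by simp) (by simp) (hset _ _ (by simp) (by simp) (by simp)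
            (hmono (fun v => ?_) hI))
          have := v.2
          omega) (by
          intro m hm s'' hv _ hI
          have hsk := hv .k (by simp [greedyStepCmd, degreeCmd, Cmd.Writes])
          refine GreedyInvariant.step hm ?_ ?_ (hset _ _ (by simp) (by simp) (by simp) hI)
          · simpa using hsk
          · simp)
      exact hmono (fun v => by omega) hinner)
  obtain ⟨S, h1, h2, h3, -, -, h6⟩ := houter
  have hlt : ∀ v, G.degree v < n - 0 := fun v => by
    simpa using G.degree_lt_card_verts v
  change (Cmd.eval G _ s₀).v .ann = _
  rw [← h1]
  have h3' : ∑ v ∈ S, G.degree v ≤ #G.edgeFinset := by omega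
  rcases h6 with h6 | ⟨d, hd1, hd2, hd3⟩
  · have hS : S = univ := eq_univ_of_forall fun v => h6 v (hlt v)
    exact (G.annihilationNumber_eq_card (d := n) (fun v _ => (hlt v).le)
      (fun v hv => absurd (h6 v (hlt v)) hv) h3' (.inl hS)).symm
  · exact (G.annihilationNumber_eq_card hd2 hd3 h3' (.inr (by rwa [h2]))).symm

theorem Cmd.eval_cond_pos {e : Expr} {p q : Cmd} {s : Store} (h : e.eval G s ≠ 0) :
    (Cmd.cond e p q).eval G s = p.eval G s := if_pos h

theorem Cmd.eval_cond_neg {e : Expr} {p q : Cmd} {s : Store} (h : e.eval G s = 0) :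
    (Cmd.cond e p q).eval G s = q.eval G s := if_neg (not_not.2 h)

/-! ### Repetition -/

/-- A command that increases a potential unless a final condition holds, is repeated until this
condition holds or the potential is large. -/
theorem eval_repeatCmd {p : Cmd} (Q T : (Arr → ℕ → ℕ) → Prop) (μ : (Arr → ℕ → ℕ) → ℕ) {s : Store}
    (x : Var) (hx : x ≠ .r ∧ x ≠ .r' ∧ ¬ p.Writes x)
    (h : ∀ s' : Store, s'.v x = s.v x → Q s'.a → Q (p.eval G s').a ∧
      ((T s'.a ∧ T (p.eval G s').a) ∨ (¬ T s'.a ∧ μ s'.a + 1 ≤ μ (p.eval G s').a)))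
    (hQ : Q s.a) :
    Q ((repeatCmd p).eval G s).a ∧
      (T ((repeatCmd p).eval G s).a ∨ (n + 2) * (n + 2) ≤ μ ((repeatCmd p).eval G s).a) := by
  have houter := Cmd.eval_loop_induction_frame G (x := .r) (c := 2) (p := .loop .r' 2 p) (s := s)
    -- As long as the final condition fails, the potential is at least the number of repetitions
    -- carried out so far.
    (fun k s' => Q s'.a ∧ (T s'.a ∨ (n + 2 - k) * (n + 2) ≤ μ s'.a)) ⟨hQ, .inr (by simp)⟩ (by
      rintro k hk s' hv - ⟨hQ', hT'⟩
      have hxs : s'.v x = s.v x := hv x (by simp [Cmd.Writes, hx])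
      have hinner := Cmd.eval_loop_induction_frame G (x := .r') (c := 2) (p := p)
        (s := s'.setV .r k) (fun m s'' => Q s''.a ∧
          (T s''.a ∨ (n + 2 - (k + 1)) * (n + 2) + (n + 2 - m) ≤ μ s''.a))
        ⟨hQ', by simpa using hT'⟩ (by
          rintro m hm s'' hv' - ⟨hQ'', hT''⟩
          have hxs' : s''.v x = s.v x := by
            rw [hv' x (by simp [Cmd.Writes, hx]), ← hxs]
            simp [hx.1]
          obtain ⟨h1, h2⟩ := h (s''.setV .r' m) (by simp [hx.2.1, hxs']) hQ''
          refine ⟨h1, ?_⟩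
          rcases h2 with ⟨-, h2⟩ | ⟨h2, h3⟩
          · exact .inl h2
          · have := hT''.resolve_left h2
            simp only [Store.setV_a] at h3
            right
            omega)
      refine ⟨hinner.1, hinner.2.imp_right fun h => ?_⟩
      have : n + 2 - k = n + 2 - (k + 1) + 1 := by omega
      rw [this, Nat.succ_mul]
      exact h)
  rw [Nat.sub_zero] at houter
  exact houter

/-! ### The auction -/

theorem eval_initCmd (s : Store) : AuctionInvariant n (AdjAvoiding G ((initCmd.eval G s).v .c))
    ((initCmd.eval G s).a .mate) ((initCmd.eval G s).a .own) ((initCmd.eval G s).a .price) := by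
  have := Cmd.eval_loop_induction_frame G (x := .i) (c := 0)
    (p := .seq (.put .own (.var .i) (.const 0)) <| .seq (.put .mate (.var .i) (.const 0))
    (.put .price (.var .i) (.const 0))) (s := s)
    (fun k s' => ∀ i < n, k ≤ i → s'.a .mate i = 0 ∧ s'.a .own i = 0 ∧ s'.a .price i = 0)
    (fun i hi hi' => by omega) (by
      intro k _ s' _ _ hI i hi hki
      by_cases h : i = k
      · simp [Cmd.eval, Expr.eval, h]
      · have := hI i hi (by omega)
        simpa [Cmd.eval, Expr.eval, h] using this)
  exact .init n _ (fun i hi => (this i hi (Nat.zero_le _)).1)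
    (fun i hi => (this i hi (Nat.zero_le _)).2.1) fun i hi => (this i hi (Nat.zero_le _)).2.2

/-- The start value `n + 2` of `best` is the price ceiling. If it remains, no affordable neighbor
exists and `arg` carries no meaning. -/
theorem eval_cheapestCmd (s : Store) :
    let s' := cheapestCmd.eval G s
    s'.v .best ≤ n + 2 ∧
      (s'.v .best < n + 2 → s'.v .arg < n ∧ AdjAvoiding G (s.v .c) (s.v .i) (s'.v .arg) ∧
        s.a .price (s'.v .arg) = s'.v .best) ∧
      ∀ j < n, AdjAvoiding G (s.v .c) (s.v .i) j → s'.v .best ≤ s.a .price j := by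
  intro s'
  have := Cmd.eval_loop_induction_frame G (x := .j) (c := 0)
    (p := .cond (.adjAvoiding (.var .i) (.var .j))
      (.cond (.sub (.var .best) (.get .price (.var .j)))
      (.seq (.set .best (.get .price (.var .j))) (.set .arg (.var .j))) .skip) .skip)
    (s := s.setV .best (n + 2))
    (fun k s' => s'.v .best ≤ n + 2 ∧
      (s'.v .best < n + 2 → s'.v .arg < n ∧ AdjAvoiding G (s.v .c) (s.v .i) (s'.v .arg) ∧
        s.a .price (s'.v .arg) = s'.v .best) ∧
      ∀ j < n, k ≤ j → AdjAvoiding G (s.v .c) (s.v .i) j → s'.v .best ≤ s.a .price j)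
    ⟨by simp, by simp, fun j hj hj' => by omega⟩ (by
      rintro k hk s' hv ha ⟨h1, h2, h3⟩
      have vc : s'.v .c = s.v .c := by rw [hv .c (by simp [Cmd.Writes])]; simp
      have vi : s'.v .i = s.v .i := by rw [hv .i (by simp [Cmd.Writes])]; simp
      have ap : s'.a .price = s.a .price := ha .price (by simp [Cmd.WritesArr])
      have hcond : (Expr.adjAvoiding (.var .i) (.var .j)).eval G (s'.setV .j k) ≠ 0 ↔
          AdjAvoiding G (s.v .c) (s.v .i) k := by
        rw [Expr.eval_adjAvoiding_ne_zero_iff]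
        simp [Expr.eval, vc, vi]
      have hlast : ∀ j, k ≤ j → j = k ∨ k + 1 ≤ j := fun j hj => by omega
      by_cases c1 : AdjAvoiding G (s.v .c) (s.v .i) k
      · rw [Cmd.eval_cond_pos (hcond.2 c1)]
        by_cases c2 : s.a .price k < s'.v .best
        · rw [Cmd.eval_cond_pos (by simp [Expr.eval, ap]; omega)]
          simp only [Cmd.eval, Expr.eval]
          refine ⟨by simp [ap]; omega, fun _ => ⟨by simpa using hk, by simpa using c1, by simp [ap]⟩,
            fun j hj hkj hadj => ?_⟩
          rcases hlast j hkj with rfl | hlt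
          · simp [ap]
          · have := h3 j hj hlt hadj
            simp [ap]; omega
        · rw [Cmd.eval_cond_neg (by simp [Expr.eval, ap]; omega)]
          refine ⟨by simpa [Cmd.eval] using h1, by simpa [Cmd.eval] using h2,
            fun j hj hkj hadj => ?_⟩
          rcases hlast j hkj with rfl | hlt
          · simp [Cmd.eval]; omega
          · simpa [Cmd.eval] using h3 j hj hlt hadj
      · rw [Cmd.eval_cond_neg (not_not.1 fun h => c1 (hcond.1 h))]
        refine ⟨by simpa [Cmd.eval] using h1, by simpa [Cmd.eval] using h2,
          fun j hj hkj hadj => ?_⟩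
        rcases hlast j hkj with rfl | hlt
        · exact absurd hadj c1
        · simpa [Cmd.eval] using h3 j hj hlt hadj)
  obtain ⟨h1, h2, h3⟩ := this
  exact ⟨h1, h2, fun j hj => h3 j hj (Nat.zero_le _)⟩

theorem eval_assignCmd (s : Store) :
    (assignCmd.eval G s).a .mate = Function.update
      (if s.a .own (s.v .arg) ≠ 0 then Function.update (s.a .mate) (s.a .own (s.v .arg) - 1) 0
        else s.a .mate) (s.v .i) (s.v .arg + 1) ∧
    (assignCmd.eval G s).a .own = Function.update (s.a .own) (s.v .arg) (s.v .i + 1) ∧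
    (assignCmd.eval G s).a .price = Function.update (s.a .price) (s.v .arg) (s.v .best + 1) := by
  by_cases h : s.a .own (s.v .arg) = 0 <;> simp [assignCmd, Cmd.eval, Expr.eval, h]

/-- The invariant of the auction, for the arrays of the program. -/
def AuctionArrays (E : ℕ → ℕ → Prop) (n : ℕ) (a : Arr → ℕ → ℕ) : Prop :=
  AuctionInvariant n E (a .mate) (a .own) (a .price)

/-- No vertex can bid. -/
def AuctionFinished (E : ℕ → ℕ → Prop) (n : ℕ) (a : Arr → ℕ → ℕ) : Prop :=
  ∀ i < n, CannotBid n E (a .mate) (a .price) i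

/-- The sum of all prices. -/
def priceSum (n : ℕ) (a : Arr → ℕ → ℕ) : ℕ := ∑ j ∈ range n, a .price j

theorem eval_bidCmd {s : Store} {c : ℕ} (hc : s.v .c = c) (hi : s.v .i < n)
    (h : AuctionArrays (AdjAvoiding G c) n s.a) :
    AuctionArrays (AdjAvoiding G c) n (bidCmd.eval G s).a ∧
      ((CannotBid n (AdjAvoiding G c) (s.a .mate) (s.a .price) (s.v .i) ∧
          (bidCmd.eval G s).a = s.a) ∨
        (¬ CannotBid n (AdjAvoiding G c) (s.a .mate) (s.a .price) (s.v .i) ∧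
          priceSum n s.a + 1 ≤ priceSum n (bidCmd.eval G s).a)) := by
  subst hc
  by_cases hm : s.a .mate (s.v .i) = 0
  swap
  · have e : bidCmd.eval G s = s := by simp [bidCmd, Cmd.eval, Expr.eval, hm]
    rw [e]
    exact ⟨h, .inl ⟨.inl hm, rfl⟩⟩
  set s' := cheapestCmd.eval G s with hs'
  obtain ⟨h1, h2, h3⟩ := eval_cheapestCmd (G := G) s
  rw [← hs'] at h1 h2 h3
  have va : s'.a = s.a := funext fun k => Cmd.eval_a_of_not_writesArr G
    (by simp [cheapestCmd, Cmd.WritesArr]) s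
  have vi : s'.v .i = s.v .i := Cmd.eval_v_of_not_writes G (by simp [cheapestCmd, Cmd.Writes]) s
  have e : bidCmd.eval G s = if s'.v .best < n + 2 then assignCmd.eval G s' else s' := by
    simp only [bidCmd, Cmd.eval, Expr.eval, ← hs', hm, ne_eq, not_true_eq_false, if_false,
      Nat.sub_ne_zero_iff_lt]
  by_cases hb : s'.v .best < n + 2
  · rw [e, if_pos hb]
    obtain ⟨h4, h5, h6⟩ := h2 hb
    obtain ⟨a1, a2, a3⟩ := eval_assignCmd (G := G) s'
    rw [va, vi] at a1 a2
    rw [va, ← h6] at a3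
    refine ⟨?_, .inr ⟨?_, ?_⟩⟩
    · rw [AuctionArrays, a1, a2, a3]
      exact AuctionInvariant.bid h hi h4 hm h5 (fun j hj hE => h6 ▸ h3 j hj hE) (h6 ▸ hb)
    · rintro (h | h)
      · exact h hm
      · have := h _ h4 h5
        omega
    · rw [priceSum, priceSum, a3, sum_update_of_mem (mem_range.2 h4),
        ← add_sum_erase _ _ (mem_range.2 h4), erase_eq]
      omega
  · rw [e, if_neg hb, va]
    refine ⟨h, .inl ⟨.inr fun j hj hE => ?_, rfl⟩⟩
    have := h3 j hj hE
    omega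

/-- Until the first bid of a round nothing changes, so a round without bids has checked all vertices
in one and the same state. Every bid raises the sum of the prices. -/
theorem eval_bidRound {s : Store} {c : ℕ} (hc : s.v .c = c)
    (h : AuctionArrays (AdjAvoiding G c) n s.a) :
    AuctionArrays (AdjAvoiding G c) n ((Cmd.loop .i 0 bidCmd).eval G s).a ∧
      ((AuctionFinished (AdjAvoiding G c) n s.a ∧
          AuctionFinished (AdjAvoiding G c) n ((Cmd.loop .i 0 bidCmd).eval G s).a) ∨
        (¬ AuctionFinished (AdjAvoiding G c) n s.a ∧
          priceSum n s.a + 1 ≤ priceSum n ((Cmd.loop .i 0 bidCmd).eval G s).a)) := by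
  have := Cmd.eval_loop_induction_frame G (x := .i) (c := 0) (p := bidCmd) (s := s)
    (fun k s' => AuctionArrays (AdjAvoiding G c) n s'.a ∧
      ((s'.a = s.a ∧ ∀ i < n, k ≤ i → CannotBid n (AdjAvoiding G c) (s.a .mate) (s.a .price) i) ∨
        (¬ AuctionFinished (AdjAvoiding G c) n s.a ∧ priceSum n s.a + 1 ≤ priceSum n s'.a)))
    ⟨h, .inl ⟨rfl, fun i hi hi' => by omega⟩⟩ (by
      rintro k hk s' hv - ⟨h1, h2⟩
      have vc : s'.v .c = c := by
        rw [hv .c (by simp [bidCmd, cheapestCmd, assignCmd, Cmd.Writes]), hc]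
      obtain ⟨h3, h4⟩ := eval_bidCmd (G := G) (s := s'.setV .i k) (c := c) (by simpa using vc)
        (by simpa using hk) h1
      refine ⟨h3, ?_⟩
      simp only [Store.setV_v, Store.setV_a, Function.update_self] at h4
      rcases h2 with ⟨h2, h5⟩ | ⟨h2, h5⟩
      · rw [h2] at h4
        rcases h4 with ⟨h4, h6⟩ | ⟨h4, h6⟩
        · refine .inl ⟨h6, fun i hi hki => ?_⟩
          rcases hki.eq_or_lt with rfl | hlt
          · exact h4
          · exact h5 i hi hlt
        · exact .inr ⟨fun hf => h4 (hf k hk), h6⟩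
      · right
        refine ⟨h2, ?_⟩
        rcases h4 with ⟨h4, h6⟩ | ⟨h4, h6⟩
        · rwa [h6]
        · omega)
  refine ⟨this.1, this.2.imp_left fun h => ?_⟩
  have hfin : AuctionFinished (AdjAvoiding G c) n s.a := fun i hi => h.2 i hi (Nat.zero_le _)
  refine ⟨hfin, ?_⟩
  rw [h.1]
  exact hfin

theorem eval_auction {s : Store} {c : ℕ} (hc : s.v .c = c)
    (h : AuctionArrays (AdjAvoiding G c) n s.a) :
    IsDoubleMatching n (AdjAvoiding G c) (((repeatCmd (.loop .i 0 bidCmd)).eval G s).a .mate)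
      (((repeatCmd (.loop .i 0 bidCmd)).eval G s).a .own) ∧
    HasSmallCover n (AdjAvoiding G c) (((repeatCmd (.loop .i 0 bidCmd)).eval G s).a .mate) := by
  obtain ⟨h1, h2⟩ := eval_repeatCmd (G := G) (p := .loop .i 0 bidCmd) (s := s)
    (AuctionArrays (AdjAvoiding G c) n) (AuctionFinished (AdjAvoiding G c) n) (priceSum n) .c
    (by simp [bidCmd, cheapestCmd, assignCmd, Cmd.Writes])
    (fun s' hs' hQ => eval_bidRound (hs'.trans hc) hQ) h
  refine ⟨h1.toIsDoubleMatching, h1.hasSmallCover (fun i j hij => hij.lt) (h2.resolve_right ?_)⟩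
  have hsum : priceSum n ((repeatCmd (.loop .i 0 bidCmd)).eval G s).a ≤ n * (n + 2) := by
    simpa [priceSum] using sum_le_card_nsmul (range n) _ _ fun j hj => h1.price_le j (mem_range.1 hj)
  -- The sum of the prices is at most `n * (n + 2)`, less than the number `(n + 2) * (n + 2)` of
  -- rounds.
  nlinarith

theorem eval_countCmd (s : Store) :
    (countCmd.eval G s).v .cnt = matchedCount n (s.a .mate) := by
  have := Cmd.eval_loop_induction_frame G (x := .i) (c := 0)
    (p := .cond (.get .mate (.var .i)) (.set .cnt (.add (.var .cnt) (.const 1))) .skip)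
    (s := s.setV .cnt 0)
    (fun k s' => s'.v .cnt = ∑ i ∈ Ico k n, if s.a .mate i ≠ 0 then 1 else 0) (by simp) (by
      intro k hk s' _ ha hI
      have am : s'.a .mate = s.a .mate := ha .mate (by simp [Cmd.WritesArr])
      rw [sum_eq_sum_Ico_succ_bot (by simpa using hk), ← hI]
      simp only [Cmd.eval, Expr.eval, Store.setV_v, Store.setV_a, Function.update_self, am]
      split_ifs <;> simp [add_comm])
  rw [Nat.Ico_zero_eq_range, ← card_filter] at this
  exact this

/-! ### Two-satisfiability on the machine -/

/-- The literal is marked in the arrays. -/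
def Marked (n : ℕ) (a : Arr → ℕ → ℕ) (l : Bool × ℕ) : Prop := l.2 < n ∧ a (markArr l.1) l.2 ≠ 0

/-- The marks in `a'` arise from the marks in `a` by adding consequences. -/
structure Spreads (n : ℕ) (R : Bool × ℕ → Bool × ℕ → Prop) (a a' : Arr → ℕ → ℕ) : Prop where
  mono : ∀ l, Marked n a l → Marked n a' l
  sound : ∀ S : Set (Bool × ℕ), (∀ x y, x ∈ S → R x y → y ∈ S) → (∀ l, Marked n a l → l ∈ S) →
    ∀ l, Marked n a' l → l ∈ S

theorem Spreads.refl (R : Bool × ℕ → Bool × ℕ → Prop) (a : Arr → ℕ → ℕ) : Spreads n R a a :=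
  ⟨fun _ h => h, fun _ _ h => h⟩

/-- Soundness is phrased through sets closed under `R`, which lets it compose without any
concatenation of paths. -/
theorem Spreads.trans {R : Bool × ℕ → Bool × ℕ → Prop} {a a' a'' : Arr → ℕ → ℕ}
    (h : Spreads n R a a') (h' : Spreads n R a' a'') : Spreads n R a a'' :=
  ⟨fun l hl => h'.mono l (h.mono l hl), fun S hS hl => h'.sound S hS (h.sound S hS hl)⟩

theorem markArr_injective : Function.Injective markArr := by
  intro b b'
  cases b <;> cases b' <;> simp [markArr]

theorem marked_update_iff {a : Arr → ℕ → ℕ} {b : Bool} {w : ℕ} (hw : w < n) (l : Bool × ℕ) :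
    Marked n (Function.update a (markArr b) (Function.update (a (markArr b)) w 1)) l ↔
      l = (b, w) ∨ Marked n a l := by
  obtain ⟨b', v⟩ := l
  by_cases hb : b' = b
  · subst hb
    by_cases hv : v = w
    · subst hv; simp [Marked, hw]
    · simp [Marked, hv]
  · simp [Marked, hb, markArr_injective.ne hb]

theorem Spreads.mark {R : Bool × ℕ → Bool × ℕ → Prop} {a : Arr → ℕ → ℕ} {x : Bool × ℕ} {b : Bool}
    {w : ℕ} (hw : w < n) (hx : Marked n a x) (hR : R x (b, w)) :
    Spreads n R a (Function.update a (markArr b) (Function.update (a (markArr b)) w 1)) := by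
  refine ⟨fun l hl => (marked_update_iff hw l).2 (.inr hl), fun S hS hl l hl' => ?_⟩
  rcases (marked_update_iff hw l).1 hl' with rfl | hl'
  · exact hS x _ (hl x hx) hR
  · exact hl l hl'

theorem eval_markPartnerCmd (k : Arr) (s : Store) :
    ((markPartnerCmd k).eval G s).a = Function.update s.a (markArr true)
      (Function.update (s.a (markArr true))
        (if s.a k (s.v .i) = 0 then s.v .i else s.a k (s.v .i) - 1) 1) := by
  by_cases h : s.a k (s.v .i) = 0 <;> simp [markPartnerCmd, Cmd.eval, Expr.eval, h, markArr]

theorem eval_negStepCmd {s : Store} {E : ℕ → ℕ → Prop} (hi : s.v .i < n)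
    (hM : IsDoubleMatching n E (s.a .mate) (s.a .own)) :
    Spreads n (LiteralStep n E (s.a .mate) (s.a .own)) s.a (negStepCmd.eval G s).a ∧
      ∀ y, Marked n s.a (false, s.v .i) →
        LiteralStep n E (s.a .mate) (s.a .own) (false, s.v .i) y →
        Marked n (negStepCmd.eval G s).a y := by
  by_cases h : s.a .neg (s.v .i) = 0
  · have e : negStepCmd.eval G s = s := by simp [negStepCmd, Cmd.eval, Expr.eval, h]
    rw [e]
    exact ⟨.refl _ _, fun y hy => absurd h hy.2⟩
  set s₁ := (markPartnerCmd .mate).eval G s with hs₁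
  have e : negStepCmd.eval G s = (markPartnerCmd .own).eval G s₁ := by
    simp [negStepCmd, Cmd.eval, Expr.eval, h, hs₁]
  have vi : s₁.v .i = s.v .i :=
    Cmd.eval_v_of_not_writes G (by simp [markPartnerCmd, Cmd.Writes]) s
  have ao : s₁.a .own = s.a .own :=
    Cmd.eval_a_of_not_writesArr G (by simp [markPartnerCmd, Cmd.WritesArr]) s
  have a₁ := eval_markPartnerCmd (G := G) .mate s
  have a₂ := eval_markPartnerCmd (G := G) .own s₁
  rw [← hs₁] at a₁
  rw [vi, ao] at a₂
  set w := if s.a .mate (s.v .i) = 0 then s.v .i else s.a .mate (s.v .i) - 1 with hw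
  set w' := if s.a .own (s.v .i) = 0 then s.v .i else s.a .own (s.v .i) - 1 with hw'
  have hwR : w < n ∧ LiteralStep n E (s.a .mate) (s.a .own) (false, s.v .i) (true, w) := by
    by_cases h0 : s.a .mate (s.v .i) = 0
    · rw [hw, if_pos h0]
      exact ⟨hi, .free_mate hi h0⟩
    · obtain ⟨j, hj, hmj⟩ := hM.exists_of_mate_ne_zero hi h0
      rw [hw, if_neg h0, hmj]
      exact ⟨hj, .mate hi hj hmj⟩
  have hwR' : w' < n ∧ LiteralStep n E (s.a .mate) (s.a .own) (false, s.v .i) (true, w') := by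
    by_cases h0 : s.a .own (s.v .i) = 0
    · rw [hw', if_pos h0]
      exact ⟨hi, .free_own hi h0⟩
    · obtain ⟨j, hj, hmj⟩ := hM.exists_of_own_ne_zero hi h0
      rw [hw', if_neg h0, hmj]
      exact ⟨hj, .own hi hj hmj⟩
  have hx : Marked n s.a (false, s.v .i) := ⟨hi, h⟩
  have g₁ := Spreads.mark hwR.1 hx hwR.2
  rw [← a₁] at g₁
  have g₂ := Spreads.mark hwR'.1 (g₁.mono _ hx) hwR'.2
  rw [← a₂, ← e] at g₂
  refine ⟨g₁.trans g₂, fun y _ hy => ?_⟩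
  have m₁ : Marked n (negStepCmd.eval G s).a (true, w) :=
    g₂.mono _ (by rw [a₁]; exact (marked_update_iff hwR.1 _).2 (.inl rfl))
  have m₂ : Marked n (negStepCmd.eval G s).a (true, w') := by
    rw [e, a₂]
    exact (marked_update_iff hwR'.1 _).2 (.inl rfl)
  cases hy with
  | mate _ _ h => simpa [hw, h] using m₁
  | own _ _ h => simpa [hw', h] using m₂
  | free_mate _ h => simpa [hw, h] using m₁
  | free_own _ h => simpa [hw', h] using m₂

theorem eval_posStepCmd {s : Store} {c : ℕ} {m o : ℕ → ℕ} (hc : s.v .c = c) (hi : s.v .i < n) :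
    Spreads n (LiteralStep n (AdjAvoiding G c) m o) s.a (posStepCmd.eval G s).a ∧
      ∀ y, Marked n s.a (true, s.v .i) →
        LiteralStep n (AdjAvoiding G c) m o (true, s.v .i) y →
        Marked n (posStepCmd.eval G s).a y := by
  subst hc
  by_cases h : s.a .pos (s.v .i) = 0
  · have e : posStepCmd.eval G s = s := by simp [posStepCmd, Cmd.eval, Expr.eval, h]
    rw [e]
    exact ⟨.refl _ _, fun y hy => absurd h hy.2⟩
  rw [posStepCmd, Cmd.eval_cond_pos (by exact h)]
  have hx : Marked n s.a (true, s.v .i) := ⟨hi, h⟩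
  have := Cmd.eval_loop_induction_frame G (x := .j) (c := 0)
    (p := .cond (.adjAvoiding (.var .i) (.var .j)) (.put .neg (.var .j) (.const 1)) .skip) (s := s)
    (fun k s' => Spreads n (LiteralStep n (AdjAvoiding G (s.v .c)) m o) s.a s'.a ∧
      ∀ j < n, k ≤ j → AdjAvoiding G (s.v .c) (s.v .i) j → Marked n s'.a (false, j))
    ⟨.refl _ _, fun j hj hj' => by omega⟩ (by
      rintro k hk s' hv - ⟨h1, h2⟩
      have vc : s'.v .c = s.v .c := hv .c (by simp [Cmd.Writes])
      have vi : s'.v .i = s.v .i := hv .i (by simp [Cmd.Writes])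
      have hcond : (Expr.adjAvoiding (.var .i) (.var .j)).eval G (s'.setV .j k) ≠ 0 ↔
          AdjAvoiding G (s.v .c) (s.v .i) k := by
        rw [Expr.eval_adjAvoiding_ne_zero_iff]
        simp [Expr.eval, vc, vi]
      have hlast : ∀ j, k ≤ j → j = k ∨ k + 1 ≤ j := fun j hj => by omega
      by_cases c1 : AdjAvoiding G (s.v .c) (s.v .i) k
      · rw [Cmd.eval_cond_pos (hcond.2 c1)]
        have e : ((Cmd.put .neg (.var .j) (.const 1)).eval G (s'.setV .j k)).a =
            Function.update s'.a (markArr false) (Function.update (s'.a (markArr false)) k 1) := by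
          simp [Cmd.eval, Expr.eval, markArr]
        rw [e]
        have hk : k < n := hk
        have g := Spreads.mark hk (h1.mono _ hx)
          (LiteralStep.edge (mate := m) (own := o) (n := n) c1)
        refine ⟨h1.trans g, fun j hj hkj hadj => ?_⟩
        rcases hlast j hkj with rfl | hlt
        · exact (marked_update_iff hk _).2 (.inl rfl)
        · exact g.mono _ (h2 j hj hlt hadj)
      · rw [Cmd.eval_cond_neg (not_not.1 fun h => c1 (hcond.1 h))]
        refine ⟨h1, fun j hj hkj hadj => ?_⟩
        rcases hlast j hkj with rfl | hlt
        · exact absurd hadj c1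
        · exact h2 j hj hlt hadj)
  refine ⟨this.1, fun y _ hy => ?_⟩
  cases hy with
  | edge hE => exact this.2 _ hE.lt.2 (Nat.zero_le _) hE

/-- Marks are never removed during the round, so a literal marked at its start is still marked when
its vertex is processed, and its immediate consequences get marked then. -/
theorem eval_closureRound {s : Store} {c : ℕ} (hc : s.v .c = c)
    (hM : IsDoubleMatching n (AdjAvoiding G c) (s.a .mate) (s.a .own)) :
    Spreads n (LiteralStep n (AdjAvoiding G c) (s.a .mate) (s.a .own)) s.a
        ((Cmd.loop .i 0 (.seq negStepCmd posStepCmd)).eval G s).a ∧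
      ∀ x y, Marked n s.a x → LiteralStep n (AdjAvoiding G c) (s.a .mate) (s.a .own) x y →
        Marked n ((Cmd.loop .i 0 (.seq negStepCmd posStepCmd)).eval G s).a y := by
  have := Cmd.eval_loop_induction_frame G (x := .i) (c := 0) (p := .seq negStepCmd posStepCmd)
    (s := s)
    (fun k s' => Spreads n (LiteralStep n (AdjAvoiding G c) (s.a .mate) (s.a .own)) s.a s'.a ∧
      ∀ b i y, k ≤ i → Marked n s.a (b, i) →
        LiteralStep n (AdjAvoiding G c) (s.a .mate) (s.a .own) (b, i) y → Marked n s'.a y)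
    ⟨.refl _ _, fun b i y hi hx => absurd hx.1 (by simpa using hi)⟩ (by
      rintro k hk s' hv ha ⟨h1, h2⟩
      have vc : s'.v .c = c := by
        rw [hv .c (by simp [posStepCmd, negStepCmd, markPartnerCmd, Cmd.Writes]), hc]
      have am : s'.a .mate = s.a .mate :=
        ha _ (by simp [posStepCmd, negStepCmd, markPartnerCmd, Cmd.WritesArr])
      have ao : s'.a .own = s.a .own :=
        ha _ (by simp [posStepCmd, negStepCmd, markPartnerCmd, Cmd.WritesArr])
      obtain ⟨g1, g2⟩ := eval_negStepCmd (G := G) (s := s'.setV .i k) (E := AdjAvoiding G c)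
        (by simpa using hk) (by simpa [am, ao] using hM)
      set s₁ := negStepCmd.eval G (s'.setV .i k) with hs₁
      have vc' : s₁.v .c = c := by
        rw [hs₁, Cmd.eval_v_of_not_writes G (by simp [negStepCmd, markPartnerCmd, Cmd.Writes])]
        simpa using vc
      have vi' : s₁.v .i = k := by
        rw [hs₁, Cmd.eval_v_of_not_writes G (by simp [negStepCmd, markPartnerCmd, Cmd.Writes])]
        simp
      obtain ⟨g3, g4⟩ := eval_posStepCmd (G := G) (s := s₁) (m := s.a .mate) (o := s.a .own) vc'
        (by simpa [vi'] using hk)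
      simp only [Store.setV_a, Store.setV_v, Function.update_self, am, ao] at g1 g2
      rw [vi'] at g4
      refine ⟨h1.trans (g1.trans g3), fun b i y hki hx hR => ?_⟩
      rcases hki.eq_or_lt with rfl | hlt
      · cases b with
        | true => exact g4 y (g1.mono _ (h1.mono _ hx)) hR
        | false => exact g3.mono _ (g2 y (h1.mono _ hx) hR)
      · exact (g1.trans g3).mono _ (h2 b i y hlt hx hR))
  exact ⟨this.1, fun x y hx hR => this.2 x.1 x.2 y (Nat.zero_le _) hx hR⟩

open Classical in
/-- The number of marked literals. -/
noncomputable def markCount (n : ℕ) (a : Arr → ℕ → ℕ) : ℕ :=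
  #{l ∈ (univ : Finset Bool) ×ˢ range n | Marked n a l}

/-- The potential is the number of marked literals. A round that adds no mark shows that the marked
set is closed under implication, so that it contains everything reachable from `l`. -/
theorem eval_closureCmd {s : Store} {c : ℕ} {l : Bool × ℕ} (hc : s.v .c = c)
    (hM : IsDoubleMatching n (AdjAvoiding G c) (s.a .mate) (s.a .own))
    (hl : ∀ x, Marked n s.a x ↔ x = l) (x : Bool × ℕ) :
    Marked n (closureCmd.eval G s).a x ↔
      ReflTransGen (LiteralStep n (AdjAvoiding G c) (s.a .mate) (s.a .own)) l x := by
  classical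
  set R := LiteralStep n (AdjAvoiding G c) (s.a .mate) (s.a .own) with hR
  obtain ⟨⟨-, -, -, h1⟩, h2⟩ := eval_repeatCmd (G := G) (p := .loop .i 0 (.seq negStepCmd posStepCmd))
    (s := s)
    (fun a => a .mate = s.a .mate ∧ a .own = s.a .own ∧ Marked n a l ∧
      ∀ x, Marked n a x → ReflTransGen R l x)
    (fun a => ∀ x, ReflTransGen R l x → Marked n a x) (markCount n) .c
    (by simp [posStepCmd, negStepCmd, markPartnerCmd, Cmd.Writes]) (by
      rintro s' hs' ⟨am, ao, hl', hreach⟩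
      obtain ⟨g1, g2⟩ := eval_closureRound (G := G) (s := s') (hs'.trans hc) (by rwa [am, ao])
      have am' := Cmd.eval_a_of_not_writesArr G (p := .loop .i 0 (.seq negStepCmd posStepCmd))
        (k := .mate) (by simp [posStepCmd, negStepCmd, markPartnerCmd, Cmd.WritesArr]) s'
      have ao' := Cmd.eval_a_of_not_writesArr G (p := .loop .i 0 (.seq negStepCmd posStepCmd))
        (k := .own) (by simp [posStepCmd, negStepCmd, markPartnerCmd, Cmd.WritesArr]) s'
      rw [am, ao, ← hR] at g1 g2
      refine ⟨⟨am'.trans am, ao'.trans ao, g1.mono l hl',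
        g1.sound {x | ReflTransGen R l x} (fun x y hx hxy => hx.tail hxy) hreach⟩, ?_⟩
      by_cases hT : ∀ x, ReflTransGen R l x → Marked n s'.a x
      · exact .inl ⟨hT, fun x hx => g1.mono x (hT x hx)⟩
      · refine .inr ⟨hT, Nat.succ_le_of_lt (card_lt_card ?_)⟩
        refine ⟨fun x hx => ?_, fun hsub => hT fun x hx => ?_⟩
        · rw [mem_filter] at hx ⊢
          exact ⟨hx.1, g1.mono x hx.2⟩
        · induction hx with
          | refl => exact hl'
          | tail _ hxy ih =>
            have hy := g2 _ _ ih hxy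
            exact (mem_filter.1 (hsub (mem_filter.2
              ⟨mem_product.2 ⟨mem_univ _, mem_range.2 hy.1⟩, hy⟩))).2)
    ⟨rfl, rfl, (hl l).2 rfl, fun x hx => by rw [(hl x).1 hx]⟩
  -- There are only `2 * n` literals, fewer than `(n + 2) * (n + 2)`.
  refine ⟨h1 x, h2.resolve_right (fun h => ?_) x⟩
  have := h.trans (card_filter_le _ _)
  rw [card_product, card_range] at this
  simp only [card_univ, Fintype.card_bool] at this
  nlinarith

theorem eval_reachCmd {s : Store} {c u : ℕ} (b : Bool) (hc : s.v .c = c) (hu : s.v .u = u)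
    (hun : u < n) (hM : IsDoubleMatching n (AdjAvoiding G c) (s.a .mate) (s.a .own)) (x : Bool × ℕ) :
    Marked n ((reachCmd b).eval G s).a x ↔
      ReflTransGen (LiteralStep n (AdjAvoiding G c) (s.a .mate) (s.a .own)) (b, u) x := by
  have hclear := Cmd.eval_loop_induction_frame G (x := .i) (c := 0)
    (p := .seq (.put .pos (.var .i) (.const 0)) (.put .neg (.var .i) (.const 0))) (s := s)
    (fun k s' => ∀ i < n, k ≤ i → s'.a .pos i = 0 ∧ s'.a .neg i = 0)
    (fun i hi hi' => by omega) (by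
      intro k _ s' _ _ hI i hi hki
      by_cases h : i = k
      · simp [Cmd.eval, Expr.eval, h]
      · have := hI i hi (by omega)
        simpa [Cmd.eval, Expr.eval, h] using this)
  set s₁ := clearCmd.eval G s with hs₁
  have hnone : ∀ x, ¬ Marked n s₁.a x := by
    rintro ⟨b', i⟩ ⟨hi, h⟩
    have := hclear i hi (Nat.zero_le i)
    cases b'
    · exact h this.2
    · exact h this.1
  have vc : s₁.v .c = s.v .c := Cmd.eval_v_of_not_writes G (by simp [clearCmd, Cmd.Writes]) s
  have vu : s₁.v .u = s.v .u := Cmd.eval_v_of_not_writes G (by simp [clearCmd, Cmd.Writes]) s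
  have am : s₁.a .mate = s.a .mate :=
    Cmd.eval_a_of_not_writesArr G (by simp [clearCmd, Cmd.WritesArr]) s
  have ao : s₁.a .own = s.a .own :=
    Cmd.eval_a_of_not_writesArr G (by simp [clearCmd, Cmd.WritesArr]) s
  have hm : ∀ k : Arr, k = .mate ∨ k = .own → (s₁.setA (markArr b) u 1).a k = s.a k := by
    rintro k (rfl | rfl) <;> cases b <;> simp [markArr, am, ao]
  have e : (reachCmd b).eval G s = closureCmd.eval G (s₁.setA (markArr b) u 1) := by
    simp [reachCmd, Cmd.eval, Expr.eval, ← hs₁, vu, hu]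
  rw [e, ← hm .mate (.inl rfl), ← hm .own (.inr rfl)]
  refine eval_closureCmd (s := s₁.setA (markArr b) u 1) (vc.trans hc) ?_ (fun x => ?_) x
  · rwa [hm .mate (.inl rfl), hm .own (.inr rfl)]
  · rw [Store.setA_a, marked_update_iff hun]
    simp [hnone]

theorem not_writes_reachCmd (b : Bool) {x : Var} (hx : x ∉ [Var.i, .j, .r, .r']) :
    ¬ (reachCmd b).Writes x := by
  simp only [List.mem_cons, List.not_mem_nil, or_false, not_or] at hx
  simp [reachCmd, clearCmd, closureCmd, repeatCmd, posStepCmd, negStepCmd, markPartnerCmd,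
    Cmd.Writes, hx]

theorem not_writesArr_reachCmd (b : Bool) {k : Arr} (hk : k ≠ .pos ∧ k ≠ .neg) :
    ¬ (reachCmd b).WritesArr k := by
  have : k ≠ markArr b := by cases b <;> simp [markArr, hk]
  simp [reachCmd, clearCmd, closureCmd, repeatCmd, posStepCmd, negStepCmd, markPartnerCmd,
    Cmd.WritesArr, hk, this]

theorem eval_splitsCmd {s : Store} {c : ℕ} (hc : s.v .c = c)
    (hM : IsDoubleMatching n (AdjAvoiding G c) (s.a .mate) (s.a .own)) :
    (splitsCmd.eval G s).v .ok ≠ 0 ↔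
      SplitsMatching n (AdjAvoiding G c) (s.a .mate) (s.a .own) := by
  rw [hM.splitsMatching_iff fun i j h => h.symm]
  set R := LiteralStep n (AdjAvoiding G c) (s.a .mate) (s.a .own) with hR
  have := Cmd.eval_loop_induction_frame G (x := .u) (c := 0)
    (p := .seq (reachCmd true) <| .seq (.set .f (.get .neg (.var .u))) <| .seq (reachCmd false) <|
      .cond (.ite (.var .f) (.get .pos (.var .u)) (.const 0)) (.set .ok (.const 0)) .skip)
    (s := s.setV .ok 1)
    (fun k s' => s'.v .ok ≠ 0 ↔ ∀ u < n, k ≤ u → ¬ (ReflTransGen R (true, u) (false, u) ∧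
      ReflTransGen R (false, u) (true, u)))
    ⟨fun _ u hu hu' => by omega, fun _ => by simp⟩ (by
      intro k hk s' hv ha hI
      have vc : s'.v .c = c := by
        rw [hv .c (by simp [Cmd.Writes, not_writes_reachCmd])]
        simpa using hc
      have am : s'.a .mate = s.a .mate := ha _ (by simp [Cmd.WritesArr, not_writesArr_reachCmd])
      have ao : s'.a .own = s.a .own := ha _ (by simp [Cmd.WritesArr, not_writesArr_reachCmd])
      have hk : k < n := hk
      have r₁ := eval_reachCmd (G := G) (s := s'.setV .u k) (c := c) (u := k) true (by simpa using vc)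
        (by simp) hk (by simpa [am, ao] using hM) (false, k)
      set s₁ := (reachCmd true).eval G (s'.setV .u k) with hs₁
      have f₁ : ∀ x : Var, x ∉ [Var.i, .j, .r, .r'] → s₁.v x = (s'.setV .u k).v x := fun x hx =>
        Cmd.eval_v_of_not_writes G (not_writes_reachCmd true hx) _
      have g₁ : ∀ l : Arr, l ≠ .pos ∧ l ≠ .neg → s₁.a l = s'.a l := fun l hl =>
        Cmd.eval_a_of_not_writesArr G (not_writesArr_reachCmd true hl) _
      have vu₁ : s₁.v .u = k := by rw [f₁ .u (by simp)]; simp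
      -- The outcome of the first search is saved in `f`, because the second search clears the
      -- marks.
      set s₂ := s₁.setV .f (s₁.a .neg k) with hs₂
      have r₂ := eval_reachCmd (G := G) (s := s₂) (c := c) (u := k) false
        (by simp [hs₂, f₁, vc]) (by simp [hs₂, vu₁]) hk (by simpa [hs₂, g₁, am, ao] using hM) (true, k)
      set s₃ := (reachCmd false).eval G s₂ with hs₃
      have f₃ : ∀ x : Var, x ∉ [Var.i, .j, .r, .r'] → s₃.v x = s₂.v x := fun x hx =>
        Cmd.eval_v_of_not_writes G (not_writes_reachCmd false hx) _
      simp only [Store.setV_a, am, ao, Marked, markArr, hk, true_and, ← hR] at r₁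
      simp only [hs₂, Store.setV_a, g₁ .mate (by simp), g₁ .own (by simp), am, ao, Marked, markArr,
        hk, true_and, ← hR] at r₂
      have vu₃ : s₃.v .u = k := by rw [f₃ .u (by simp)]; simp [hs₂, vu₁]
      have vf₃ : s₃.v .f = s₁.a .neg k := by rw [f₃ .f (by simp)]; simp [hs₂]
      have vok₃ : s₃.v .ok = s'.v .ok := by
        rw [f₃ .ok (by simp)]; simp [hs₂, f₁]
      have e : (Cmd.seq (reachCmd true) <| .seq (.set .f (.get .neg (.var .u))) <|
          .seq (reachCmd false) <| .cond (.ite (.var .f) (.get .pos (.var .u)) (.const 0))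
            (.set .ok (.const 0)) .skip).eval G (s'.setV .u k) =
          (Cmd.cond (.ite (.var .f) (.get .pos (.var .u)) (.const 0))
            (.set .ok (.const 0)) .skip).eval G s₃ := by
        simp only [Cmd.eval, Expr.eval, ← hs₁, vu₁]
        rfl
      rw [e]
      have hcond : (Expr.ite (.var .f) (.get .pos (.var .u)) (.const 0)).eval G s₃ ≠ 0 ↔
          ReflTransGen R (true, k) (false, k) ∧ ReflTransGen R (false, k) (true, k) := by
        rw [← r₁, ← r₂]
        simp only [Expr.eval, vf₃, vu₃]
        by_cases h0 : s₁.a .neg k = 0 <;> simp [h0]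
      by_cases hbad : ReflTransGen R (true, k) (false, k) ∧ ReflTransGen R (false, k) (true, k)
      · rw [Cmd.eval_cond_pos (hcond.2 hbad)]
        simp only [Cmd.eval, Expr.eval, Store.setV_v, Function.update_self, ne_eq, not_true_eq_false,
          false_iff]
        exact fun h => h k hk le_rfl hbad
      · rw [Cmd.eval_cond_neg (not_not.1 fun h => hbad (hcond.1 h)), Cmd.eval, vok₃, hI]
        constructor
        · intro h u hu hku
          rcases hku.eq_or_lt with rfl | hlt
          · exact hbad
          · exact h u hu hlt
        · exact fun h u hu hku => h u hu (by omega))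
  refine Iff.trans this ⟨fun h u hu => h u hu (Nat.zero_le u), fun h u hu _ => h u hu⟩

/-! ### The decision procedure -/

/-- The criterion holds for any maximum matching, so it is enough that some matching with a small
cover governs the outcome. A failed test leaves `res` alone, which makes the loop over `c` a
disjunction. -/
theorem eval_testCmd {s : Store} {c : ℕ} (hc : s.v .c = c) :
    ∃ mate own : ℕ → ℕ, IsDoubleMatching n (AdjAvoiding G c) mate own ∧
      HasSmallCover n (AdjAvoiding G c) mate ∧
      (SplitsMatching n (AdjAvoiding G c) mate own ∧
        matchedCount n mate + 2 * s.v .ann + 2 ≤ 2 * n → (testCmd.eval G s).v .res = 1) ∧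
      (¬ (SplitsMatching n (AdjAvoiding G c) mate own ∧
        matchedCount n mate + 2 * s.v .ann + 2 ≤ 2 * n) →
          (testCmd.eval G s).v .res = s.v .res) := by
  subst hc
  have frame : ∀ {p : Cmd} {x : Var} (s : Store), ¬ p.Writes x → (p.eval G s).v x = s.v x :=
    fun s h => Cmd.eval_v_of_not_writes G h s
  set s₁ := initCmd.eval G s with hs₁
  set s₂ := (repeatCmd (.loop .i 0 bidCmd)).eval G s₁ with hs₂
  set s₃ := countCmd.eval G s₂ with hs₃
  set s₄ := splitsCmd.eval G s₃ with hs₄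
  have w₁ : ∀ x, x ≠ .i → s₁.v x = s.v x := fun x hx => frame s (by simp [initCmd, Cmd.Writes, hx])
  have w₂ : ∀ x, x ∉ [Var.i, .j, .r, .r', .best, .arg] → s₂.v x = s₁.v x := fun x hx => by
    simp only [List.mem_cons, List.not_mem_nil, or_false, not_or] at hx
    exact frame s₁ (by simp [repeatCmd, bidCmd, cheapestCmd, assignCmd, Cmd.Writes, hx])
  have w₃ : ∀ x, x ∉ [Var.i, .cnt] → s₃.v x = s₂.v x := fun x hx => by
    simp only [List.mem_cons, List.not_mem_nil, or_false, not_or] at hx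
    exact frame s₂ (by simp [countCmd, Cmd.Writes, hx])
  have w₄ : ∀ x, x ∉ [Var.i, .j, .r, .r', .u, .f, .ok] → s₄.v x = s₃.v x := fun x hx => by
    simp only [List.mem_cons, List.not_mem_nil, or_false, not_or] at hx
    exact frame s₃ (by simp [splitsCmd, Cmd.Writes, not_writes_reachCmd, hx])
  have a₃ : s₃.a = s₂.a := funext fun k => Cmd.eval_a_of_not_writesArr G
    (by simp [countCmd, Cmd.WritesArr]) s₂
  have vc₁ : s₁.v .c = s.v .c := w₁ _ (by simp)
  have vc₃ : s₃.v .c = s.v .c := by simp [w₁, w₂, w₃]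
  have hinit := eval_initCmd (G := G) s
  rw [← hs₁, vc₁] at hinit
  obtain ⟨hM, hmax⟩ := eval_auction (G := G) vc₁ hinit
  rw [← hs₂] at hM hmax
  have hcount := eval_countCmd (n := n) (G := G) s₂
  have hsplit := eval_splitsCmd (G := G) vc₃ (by rwa [a₃])
  rw [← hs₃] at hcount
  rw [← hs₄, a₃] at hsplit
  have v₁ : s₄.v .ann = s.v .ann := by simp [w₁, w₂, w₃, w₄]
  have v₂ : s₄.v .res = s.v .res := by simp [w₁, w₂, w₃, w₄]
  have v₃ : s₄.v .cnt = matchedCount n (s₂.a .mate) := by simp [w₄, hcount]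
  have e : testCmd.eval G s = (Cmd.cond (.ite (.var .ok)
      (.le (.add (.add (.var .cnt) (.add (.var .ann) (.var .ann))) (.const 2)) (.add .order .order))
      (.const 0)) (.set .res (.const 1)) .skip).eval G s₄ := rfl
  have hcond : (Expr.ite (.var .ok)
      (.le (.add (.add (.var .cnt) (.add (.var .ann) (.var .ann))) (.const 2)) (.add .order .order))
      (.const 0)).eval G s₄ ≠ 0 ↔ SplitsMatching n (AdjAvoiding G (s.v .c)) (s₂.a .mate) (s₂.a .own) ∧
        matchedCount n (s₂.a .mate) + 2 * s.v .ann + 2 ≤ 2 * n := by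
    rw [← hsplit]
    simp only [Expr.eval, Expr.eval_le, v₁, v₃, ← two_mul]
    by_cases h0 : s₄.v .ok = 0 <;> simp [h0]
  refine ⟨s₂.a .mate, s₂.a .own, hM, hmax, fun h => ?_, fun h => ?_⟩
  · rw [e, Cmd.eval_cond_pos (hcond.2 h)]
    simp [Cmd.eval, Expr.eval]
  · rw [e, Cmd.eval_cond_neg (not_not.1 fun h' => h (hcond.1 h')), Cmd.eval, v₂]

theorem eval_decideCmd (s : Store) :
    (G.indepNum = G.annihilationNumber → (decideCmd.eval G s).v .res = 1) ∧
      (G.indepNum ≠ G.annihilationNumber → (decideCmd.eval G s).v .res = 0) := by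
  set s₁ := annihilationCmd.eval G s with hs₁
  have hann : s₁.v .ann = G.annihilationNumber := eval_annihilationCmd s
  set s₂ := s₁.setV .res (if n = s₁.v .ann then 1 else 0) with hs₂
  have e : decideCmd.eval G s = (Cmd.loop .c 0 testCmd).eval G s₂ := by
    simp only [decideCmd, Cmd.eval, Expr.eval_eq, Expr.eval]
    rfl
  obtain ⟨mate, own, hM, h1, h2⟩ := Cmd.eval_loop_induction_frame G (x := .c) (c := 0) (p := testCmd)
    (s := s₂)
    (fun k s' => ∃ mate own : ℕ → ℕ → ℕ,
      (∀ c < n, k ≤ c → IsDoubleMatching n (AdjAvoiding G c) (mate c) (own c) ∧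
        HasSmallCover n (AdjAvoiding G c) (mate c)) ∧
      ((n = G.annihilationNumber ∨ ∃ c < n, k ≤ c ∧
        SplitsMatching n (AdjAvoiding G c) (mate c) (own c) ∧
        matchedCount n (mate c) + 2 * G.annihilationNumber + 2 ≤ 2 * n) → s'.v .res = 1) ∧
      (¬ (n = G.annihilationNumber ∨ ∃ c < n, k ≤ c ∧
        SplitsMatching n (AdjAvoiding G c) (mate c) (own c) ∧
        matchedCount n (mate c) + 2 * G.annihilationNumber + 2 ≤ 2 * n) → s'.v .res = 0))
    (by
      refine ⟨fun _ _ => 0, fun _ _ => 0, fun c hc hc' => by omega, ?_, fun h => ?_⟩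
      · rintro (h | ⟨c, hc, hc', -⟩)
        · simp [hs₂, hann, ← h]
        · omega
      · push Not at h
        simp [hs₂, hann, h.1]) (by
      rintro k hk s' hv - ⟨mate, own, h1, h2, h3⟩
      have va : s'.v .ann = G.annihilationNumber := by
        rw [hv .ann (by simp [testCmd, initCmd, repeatCmd, bidCmd, cheapestCmd, assignCmd, countCmd,
          splitsCmd, Cmd.Writes, not_writes_reachCmd]), ← hann]
        simp [hs₂]
      obtain ⟨m, o, hmo, hmax, t1, t2⟩ := eval_testCmd (G := G) (s := s'.setV .c k) (c := k) (by simp)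
      have hk : k < n := hk
      simp only [Store.setV_v, ne_eq, reduceCtorEq, not_false_eq_true, Function.update_of_ne, va]
        at t1 t2
      have hne : ∀ c, k + 1 ≤ c → c ≠ k := fun c hc => by omega
      -- The arrays are overwritten for each `c`; the invariant collects the matchings of all passes
      -- in one family indexed by `c`.
      refine ⟨Function.update mate k m, Function.update own k o, fun c hc hkc => ?_, ?_, ?_⟩
      · rcases hkc.eq_or_lt with rfl | hlt
        · simpa using ⟨hmo, hmax⟩
        · simpa [hne c hlt] using h1 c hc hlt
      all_goals
        by_cases hnew : SplitsMatching n (AdjAvoiding G k) m o ∧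
          matchedCount n m + 2 * G.annihilationNumber + 2 ≤ 2 * n
      · exact fun _ => t1 hnew
      · intro h
        rw [t2 hnew]
        refine h2 (h.imp_right ?_)
        rintro ⟨c, hc, hkc, hs⟩
        rcases hkc.eq_or_lt with rfl | hlt
        · exact absurd (by simpa using hs) hnew
        · exact ⟨c, hc, hlt, by simpa [hne c hlt] using hs⟩
      · exact fun h => absurd (.inr ⟨k, hk, le_rfl, by simpa using hnew⟩) h
      · intro h
        rw [t2 hnew]
        refine h3 fun h' => h (h'.imp_right ?_)
        rintro ⟨c, hc, hkc, hs⟩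
        exact ⟨c, hc, by omega, by simpa [hne c hkc] using hs⟩)
  have key := indepNum_eq_annihilationNumber_iff (G := G) (mate := mate) (own := own)
    (fun c hc => (hM c hc (Nat.zero_le c)).1) fun c hc => (hM c hc (Nat.zero_le c)).2
  simp only [Nat.zero_le, true_and, ← key] at h1 h2
  rw [e]
  exact ⟨h1, h2⟩

end Correctness

end RAM

/-- It can be decided in polynomial time whether the independence number of a given graph equals its
annihilation number. -/
theorem theorem1 :
    RAM.PolyTimeDecidable fun (n : ℕ) (G : SimpleGraph (Fin n)) =>
      G.indepNum = G.annihilationNumber := by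
  refine ⟨RAM.decideCmd.program .res, RAM.decideCmd.cost + 3 * Polynomial.X + 4, fun n G => ?_⟩
  obtain ⟨s, ⟨t, ht, hrun⟩, hs⟩ := RAM.Cmd.program_runsIn G RAM.decideCmd_WF .res
  refine ⟨t, s, hrun, ht, ?_⟩
  rw [hs]
  exact RAM.eval_decideCmd _
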